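/- Let $\mathbb D_1^\infty=\{\zeta\in\ell^1:\ |\zeta_j|<1\text{ for all }j\ge 1\}$. A function $F:\mathbb D_1^\infty\to\mathbb C$ is analytic if it is locally bounded and, for all $\zeta\in\mathbb D_1^\infty$ and $\eta\in\ell^1$, the function $z\mapsto F(\zeta+z\eta)$ is analytic on the open set of all $z\in\mathbb C$ with $\zeta+z\eta\in\mathbb D_1^\infty$. Let $m_\infty$ be the normalized Haar measure of the infinite torus $\mathbb T^\infty$. For $1\le p<\infty$ let $\mathbf H_\infty^p$ be the normed space of all analytic functions $F$ on $\mathbb D_1^\infty$ with $$\|F\|_p^p=\sup_{0<r<1}\int_{\mathbb T^\infty}|F(rw_1,r^2w_2,\dots,r^nw_n,\dots)|^p\,\mathrm dm_\infty(w)<\infty .$$ For $n\in\mathbb N=\{1,2,\dots\}$ with prime factorization $n=p_1^{\alpha_1}\cdots p_k^{\alpha_k}$, where $p_j$ is the $j$-th prime, write $\zeta^{\alpha(n)}=\zeta_1^{\alpha_1}\cdots\zeta_k^{\alpha_k}$. A monomial expansion of $F$ is an expansion $F(\zeta)=\sum_{n=1}^\infty a_n\zeta^{\alpha(n)}$, $\zeta\in\mathbb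 D_1^\infty$, that converges absolutely and uniformly on compact subsets of $\mathbb D_1^\infty$. Theorem 3.1. Let $1\le p<\infty$ and let $X=\{X_n\}_{n=1}^\infty$ be a centered real Gaussian process on a probability space $(\Omega,\mathcal F,\mathbb P)$, not necessarily independent (that is, all finite subfamilies are jointly Gaussian, and $\mathbb E X_n=0$ for all $n$). Suppose that the covariance matrix $\mathbf K=(\mathbb E(X_mX_n))_{m,n\ge1}$ is bounded on $\ell^2$, that is, it is the matrix of a bounded linear operator on $\ell^2$ in the standard basis. Then: 1. Every $F\in\mathbf H_\infty^2$ has a unique monomial expansion $F(\zeta)=\sum_{n=1}^\infty a_n\zeta^{\alpha(n)}$, so that its randomization $$(\mathcal RF)(\zeta)=\sum_{n=1}^\infty a_nX_n\zeta^{\alpha(n)}$$ is defined as a random series. 2. $\mathcal R$ defines a bounded linear operator from $\mathbf H_\infty^2$ to $L^2(\Omega,\mathbf H_\infty^p)$, the space of (classes of) random vectors $Y:\Omega\to\mathbf H_\infty^p$ with $\int_\Omega\|Y\|_p^2\,\mathrm d\mathbb P<\infty$. 3. In particular, for every $F\in\mathbf H_\infty^2$, almost surely the series $\mathcal RF$ is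 a monomial expansion of its sum (it converges absolutely and uniformly on compact subsets of $\mathbb D_1^\infty$) and $\mathcal RF\in\mathbf H_\infty^p$. -/

import Mathlib

open MeasureTheory ProbabilityTheory Filter Topology
open scoped ENNReal

noncomputable section

namespace InfHardy

/-! ### The domain and analytic functions -/

/-- The complex Banach space of absolutely summable sequences, indexed by `0, 1, 2, …`
(so that the coordinate called `ζ_{j+1}` on paper is `ζ j`). -/
abbrev EllOne : Type := lp (fun _ : ℕ => ℂ) 1

/-- The domain of all absolutely summable sequences with entries in the open unit disk. -/
def domain : Set EllOne := {ζ | ∀ j, ‖ζ j‖ < 1}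

/-- Extension of a function on the domain by `0` to the whole Banach space; used only to talk about
one-variable slices. -/
def extendZero (F : domain → ℂ) : EllOne → ℂ := Function.extend Subtype.val F 0

/-- `F` is analytic: it is locally bounded, and for all `ζ` in the domain and `η` in the Banach
space, `z ↦ F (ζ + z η)` is analytic on the (open) set of the `z` with `ζ + z η` in the domain. -/
structure IsAnalytic (F : domain → ℂ) : Prop where
  locally_bounded : ∀ ζ : domain, ∃ M : ℝ, ∀ᶠ ξ in 𝓝 ζ, ‖F ξ‖ ≤ M
  slice : ∀ ζ : domain, ∀ η : EllOne,
    AnalyticOnNhd ℂ (fun z : ℂ => extendZero F (ζ + z • η)) {z : ℂ | (ζ : EllOne) + z • η ∈ domain}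

/-! ### Monomials and monomial expansions -/

/-- The monomial `ζ ^ α(n) = ζ_1 ^ α_1 ⋯ ζ_k ^ α_k`, where `n = p_1 ^ α_1 ⋯ p_k ^ α_k` is the prime
factorization of `n` and `p_j` is the `j`-th prime. The number of primes below `q`,
`Nat.primeCounting' q`, is the zero-based index of the prime `q`. -/
def monomial (n : ℕ+) (ζ : ℕ → ℂ) : ℂ :=
  (n : ℕ).factorization.prod fun q k => ζ (Nat.primeCounting' q) ^ k

/-- `F ζ = ∑ a_n ζ ^ α(n)` on the whole domain, the series converging absolutely, and (together with
the series of absolute values) uniformly on compact subsets of the domain. -/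
structure HasMonomialExpansion (F : domain → ℂ) (a : ℕ+ → ℂ) : Prop where
  hasSum : ∀ ζ : domain, HasSum (fun n => a n * monomial n (ζ : EllOne)) (F ζ)
  summable_norm : ∀ ζ : domain, Summable fun n => ‖a n * monomial n (ζ : EllOne)‖
  uniform : ∀ K : Set domain, IsCompact K →
    TendstoUniformlyOn (fun (s : Finset ℕ+) (ζ : domain) =>
      ∑ n ∈ s, ‖a n * monomial n (ζ : EllOne)‖)
      (fun ζ => ∑' n, ‖a n * monomial n (ζ : EllOne)‖) atTop K

open Classical in
/-- The coefficients of the monomial expansion of `F` (zero if there is no expansion). -/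
def coeff (F : domain → ℂ) : ℕ+ → ℂ :=
  if h : ∃ a, HasMonomialExpansion F a then h.choose else 0

/-- The randomization of `F` with respect to the sequence `X`: the function that is the sum of the
random series `∑ a_n X_n ζ ^ α(n)`, where the `a_n` are the monomial coefficients of `F`. -/
def randomization {Ω : Type*} (X : ℕ+ → Ω → ℝ) (F : domain → ℂ) (ω : Ω) (ζ : domain) : ℂ :=
  ∑' n, coeff F n * (X n ω : ℂ) * monomial n (ζ : EllOne)

/-! ### Hardy spaces -/

/-- The infinite torus, parametrized by angles: the point `θ` stands for the sequence
`w_{j+1} = exp (2 π i θ_j)`. -/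
abbrev Torus : Type := ℕ → UnitAddCircle

/-- The normalized Haar measure of the infinite torus: the product of the normalized arc length
measures of the circles. -/
def torusMeasure : Measure Torus :=
  Measure.infinitePi fun _ => (AddCircle.haarAddCircle : Measure UnitAddCircle)

lemma dilate_norm (r : Set.Ioo (0 : ℝ) 1) (θ : Torus) (j : ℕ) :
    ‖((r : ℝ) : ℂ) ^ (j + 1) * ((AddCircle.toCircle (θ j) : Circle) : ℂ)‖ = (r : ℝ) ^ (j + 1) := by
  rw [norm_mul, norm_pow, Circle.norm_coe, mul_one, Complex.norm_real, Real.norm_eq_abs,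
    abs_of_pos r.2.1]

lemma summable_radius (r : Set.Ioo (0 : ℝ) 1) : Summable fun j : ℕ => (r : ℝ) ^ (j + 1) :=
  (summable_nat_add_iff 1).2 (summable_geometric_of_lt_one r.2.1.le r.2.2)

/-- A point of the domain from its coordinates. -/
def mkPoint (f : ℕ → ℂ) (hf : Summable fun j => ‖f j‖) (h1 : ∀ j, ‖f j‖ < 1) : domain :=
  ⟨⟨f, memℓp_gen (by simpa using hf)⟩, h1⟩

/-- The point `(r w_1, r ^ 2 w_2, …, r ^ n w_n, …)` of the domain. -/
def dilate (r : Set.Ioo (0 : ℝ) 1) (θ : Torus) : domain :=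
  mkPoint (fun j => ((r : ℝ) : ℂ) ^ (j + 1) * ((AddCircle.toCircle (θ j) : Circle) : ℂ))
    (by simpa only [dilate_norm] using summable_radius r)
    (fun j => by
      rw [dilate_norm]
      exact pow_lt_one₀ r.2.1.le r.2.2 (Nat.succ_ne_zero j))

/-- The Hardy norm, `sup` over `0 < r < 1` of the `L ^ p` norm of
`w ↦ F (r w_1, r ^ 2 w_2, …)` on the infinite torus, with values in `[0, ∞]`. -/
def hardyENorm (p : ℝ≥0∞) (F : domain → ℂ) : ℝ≥0∞ :=
  ⨆ r : Set.Ioo (0 : ℝ) 1, eLpNorm (fun θ => F (dilate r θ)) p torusMeasure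

/-- Membership in the Hardy space: analytic with finite Hardy norm. -/
def MemHardy (p : ℝ≥0∞) (F : domain → ℂ) : Prop := IsAnalytic F ∧ hardyENorm p F < ∞

/-! ### Auxiliary facts: the Hardy space is a normed space -/

lemma extendZero_coe (F : domain → ℂ) (ζ : domain) : extendZero F ζ = F ζ :=
  Subtype.val_injective.extend_apply F 0 ζ

lemma extendZero_of_mem (F : domain → ℂ) {ζ : EllOne} (h : ζ ∈ domain) :
    extendZero F ζ = F ⟨ζ, h⟩ := extendZero_coe F ⟨ζ, h⟩

lemma EllOne.norm_apply_le (ζ : EllOne) (j : ℕ) : ‖ζ j‖ ≤ ‖ζ‖ :=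
  lp.norm_apply_le_norm one_ne_zero ζ j

lemma EllOne.summable (ζ : EllOne) : Summable fun j => ‖ζ j‖ := by
  simpa using (lp.memℓp ζ).summable (by simp)

lemma EllOne.norm_eq (ζ : EllOne) : ‖ζ‖ = ∑' j, ‖ζ j‖ := by
  simpa using lp.norm_eq_tsum_rpow (p := 1) (by simp) ζ

lemma isOpen_domain : IsOpen domain := by
  rw [Metric.isOpen_iff]
  intro ζ hζ
  have h0 : Tendsto (fun j => ‖ζ j‖) cofinite (𝓝 0) := (EllOne.summable ζ).tendsto_cofinite_zero
  have hfin : {j | ¬ ‖ζ j‖ < 1 / 2}.Finite := h0.eventually (gt_mem_nhds (by norm_num))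
  obtain ⟨δ, hδ, hδ'⟩ : ∃ δ : ℝ, 0 < δ ∧ ∀ j, ‖ζ j‖ + δ ≤ 1 := by
    rcases hfin.toFinset.eq_empty_or_nonempty with he | hne
    · refine ⟨1 / 2, by norm_num, fun j => ?_⟩
      have hj : ‖ζ j‖ < 1 / 2 := by
        by_contra hj
        have : j ∈ hfin.toFinset := hfin.mem_toFinset.2 hj
        rw [he] at this
        exact Finset.notMem_empty j this
      linarith
    · obtain ⟨i, -, hi⟩ := hfin.toFinset.exists_max_image (fun j => ‖ζ j‖) hne
      refine ⟨min (1 / 2) (1 - ‖ζ i‖), lt_min (by norm_num) (sub_pos.2 (hζ i)), fun j => ?_⟩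
      by_cases hj : ‖ζ j‖ < 1 / 2
      · have := min_le_left (1 / 2) (1 - ‖ζ i‖)
        linarith
      · have h1 := hi j (by simpa using hj)
        have := min_le_right (1 / 2) (1 - ‖ζ i‖)
        linarith
  refine ⟨δ, hδ, fun ξ hξ j => ?_⟩
  have h1 : ‖(ξ - ζ) j‖ ≤ ‖ξ - ζ‖ := EllOne.norm_apply_le _ j
  have h2 : ‖ξ - ζ‖ < δ := by simpa [dist_eq_norm] using hξ
  have h3 : ‖ξ j‖ ≤ ‖ζ j‖ + ‖(ξ - ζ) j‖ := by
    have : ξ j = ζ j + (ξ - ζ) j := by simp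
    calc ‖ξ j‖ = ‖ζ j + (ξ - ζ) j‖ := by rw [← this]
      _ ≤ _ := norm_add_le _ _
  linarith [hδ' j]

lemma IsAnalytic.continuous {F : domain → ℂ} (hF : IsAnalytic F) : Continuous F := by
  rw [continuous_iff_continuousAt]
  intro ζ
  obtain ⟨M, hM⟩ := hF.locally_bounded ζ
  obtain ⟨ε, hε, hball⟩ := Metric.isOpen_iff.1 isOpen_domain ζ ζ.2
  obtain ⟨δ', hδ', hM'⟩ := Metric.eventually_nhds_iff.1 hM
  set δ := min ε δ' with hδdef
  have hδ : 0 < δ := lt_min hε hδ'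
  have key : ∀ ξ : domain, dist ξ ζ < δ → dist (F ξ) (F ζ) ≤ (2 * M) / δ * dist ξ ζ := by
    intro ξ hξ
    by_cases hne : ξ = ζ
    · simp [hne]
    have hd : 0 < dist ξ ζ := dist_pos.2 hne
    set d := dist ξ ζ with hd'
    have hnorm : ‖(ξ : EllOne) - ζ‖ = d := by rw [hd', Subtype.dist_eq, dist_eq_norm]
    set η : EllOne := ((d⁻¹ : ℝ) : ℂ) • ((ξ : EllOne) - ζ) with hη
    have hηn : ‖η‖ = 1 := by
      rw [hη, norm_smul, hnorm, Complex.norm_real, Real.norm_eq_abs, abs_of_pos (by positivity)]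
      field_simp
    have hmem : ∀ z : ℂ, ‖z‖ < δ → (ζ : EllOne) + z • η ∈ domain := fun z hz => hball (by
      simp only [Metric.mem_ball, dist_eq_norm, add_sub_cancel_left, norm_smul, hηn, mul_one]
      exact hz.trans_le (min_le_left _ _))
    have hbd : ∀ z : ℂ, ‖z‖ < δ → ‖extendZero F (ζ + z • η)‖ ≤ M := fun z hz => by
      rw [extendZero_of_mem F (hmem z hz)]
      refine hM' ?_
      rw [Subtype.dist_eq, dist_eq_norm]
      simp only [add_sub_cancel_left, norm_smul, hηn, mul_one]
      exact hz.trans_le (min_le_right _ _)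
    have hdiff : DifferentiableOn ℂ (fun z : ℂ => extendZero F (ζ + z • η)) (Metric.ball 0 δ) :=
      (hF.slice ζ η).differentiableOn.mono fun z hz => hmem z (by simpa using hz)
    have hmaps : Set.MapsTo (fun z : ℂ => extendZero F (ζ + z • η)) (Metric.ball 0 δ)
        (Metric.closedBall ((fun z : ℂ => extendZero F (ζ + z • η)) 0) (2 * M)) := by
      intro z hz
      rw [Metric.mem_closedBall, dist_eq_norm]
      have h1 := hbd z (by simpa using hz)
      have h2 := hbd 0 (by simpa using hδ)
      have h3 := norm_sub_le (extendZero F (ζ + z • η)) (extendZero F (ζ + (0 : ℂ) • η))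
      exact h3.trans (by linarith)
    have hz : ((d : ℝ) : ℂ) ∈ Metric.ball (0 : ℂ) δ := by
      simpa [abs_of_pos hd] using hξ
    have h := Complex.dist_le_div_mul_dist_of_mapsTo_ball hdiff hmaps hz
    have hpt : (ζ : EllOne) + ((d : ℝ) : ℂ) • η = ξ := by
      rw [hη, smul_smul, ← Complex.ofReal_mul, mul_inv_cancel₀ hd.ne']
      simp
    simp only [hpt, zero_smul, add_zero, extendZero_coe, dist_zero_right, Complex.norm_real,
      Real.norm_eq_abs, abs_of_pos hd] at h
    exact h
  have hlim : Tendsto (fun ξ : domain => (2 * M) / δ * dist ξ ζ) (𝓝 ζ) (𝓝 0) := by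
    have : Continuous fun ξ : domain => (2 * M) / δ * dist ξ ζ := by fun_prop
    simpa using this.tendsto ζ
  rw [ContinuousAt, tendsto_iff_dist_tendsto_zero]
  refine squeeze_zero' (Eventually.of_forall fun _ => dist_nonneg) ?_ hlim
  filter_upwards [Metric.ball_mem_nhds ζ hδ] with ξ hξ using key ξ hξ

lemma continuous_dilate (r : Set.Ioo (0 : ℝ) 1) : Continuous (dilate r) := by
  rw [continuous_iff_continuousAt]
  intro θ
  rw [ContinuousAt, tendsto_iff_dist_tendsto_zero]
  have hdist : ∀ θ' : Torus, dist (dilate r θ') (dilate r θ) =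
      ∑' j, ‖((r : ℝ) : ℂ) ^ (j + 1) * ((AddCircle.toCircle (θ' j) : Circle) : ℂ)
        - ((r : ℝ) : ℂ) ^ (j + 1) * ((AddCircle.toCircle (θ j) : Circle) : ℂ)‖ := by
    intro θ'
    rw [Subtype.dist_eq, dist_eq_norm, EllOne.norm_eq]
    rfl
  simp only [hdist]
  have hc : Continuous fun θ' : Torus =>
      ∑' j, ‖((r : ℝ) : ℂ) ^ (j + 1) * ((AddCircle.toCircle (θ' j) : Circle) : ℂ)
        - ((r : ℝ) : ℂ) ^ (j + 1) * ((AddCircle.toCircle (θ j) : Circle) : ℂ)‖ := by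
    refine continuous_tsum (u := fun j => (r : ℝ) ^ (j + 1) + (r : ℝ) ^ (j + 1)) (fun j => ?_)
      ((summable_radius r).add (summable_radius r)) (fun j θ' => ?_)
    · have : Continuous fun θ' : Torus => ((AddCircle.toCircle (θ' j) : Circle) : ℂ) :=
        continuous_subtype_val.comp (AddCircle.continuous_toCircle.comp (continuous_apply j))
      fun_prop
    · rw [norm_norm]
      refine (norm_sub_le _ _).trans ?_
      rw [dilate_norm, dilate_norm]
  simpa using hc.tendsto θ

lemma IsAnalytic.aestronglyMeasurable {F : domain → ℂ} (hF : IsAnalytic F)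
    (r : Set.Ioo (0 : ℝ) 1) : AEStronglyMeasurable (fun θ => F (dilate r θ)) torusMeasure :=
  (hF.continuous.comp (continuous_dilate r)).aestronglyMeasurable

lemma extendZero_add (F G : domain → ℂ) : extendZero (F + G) = extendZero F + extendZero G := by
  ext ζ
  by_cases h : ζ ∈ domain
  · simp [extendZero_of_mem, h]
  · have : ¬ ∃ a : domain, (a : EllOne) = ζ := by simpa using h
    simp [extendZero, Function.extend_apply' _ _ _ this]

lemma extendZero_smul (c : ℂ) (F : domain → ℂ) : extendZero (c • F) = c • extendZero F := by
  ext ζ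
  by_cases h : ζ ∈ domain
  · simp [extendZero_of_mem, h]
  · have : ¬ ∃ a : domain, (a : EllOne) = ζ := by simpa using h
    simp [extendZero, Function.extend_apply' _ _ _ this]

lemma IsAnalytic.zero : IsAnalytic 0 where
  locally_bounded ζ := ⟨0, by simp⟩
  slice ζ η := by
    have : extendZero 0 = 0 := by
      simpa using extendZero_smul 0 0
    simp only [this]
    exact analyticOnNhd_const

lemma IsAnalytic.add {F G : domain → ℂ} (hF : IsAnalytic F) (hG : IsAnalytic G) :
    IsAnalytic (F + G) where
  locally_bounded ζ := by
    obtain ⟨M, hM⟩ := hF.locally_bounded ζ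
    obtain ⟨N, hN⟩ := hG.locally_bounded ζ
    refine ⟨M + N, ?_⟩
    filter_upwards [hM, hN] with ξ h1 h2
    exact (norm_add_le _ _).trans (add_le_add h1 h2)
  slice ζ η := by
    rw [extendZero_add]
    exact (hF.slice ζ η).add (hG.slice ζ η)

lemma IsAnalytic.smul {F : domain → ℂ} (c : ℂ) (hF : IsAnalytic F) : IsAnalytic (c • F) where
  locally_bounded ζ := by
    obtain ⟨M, hM⟩ := hF.locally_bounded ζ
    refine ⟨‖c‖ * M, ?_⟩
    filter_upwards [hM] with ξ h1
    rw [Pi.smul_apply, norm_smul]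
    gcongr
  slice ζ η := by
    rw [extendZero_smul]
    exact analyticOnNhd_const.mul (hF.slice ζ η)

lemma hardyENorm_zero (p : ℝ≥0∞) : hardyENorm p 0 = 0 := by
  simp [hardyENorm]

lemma hardyENorm_add_le {p : ℝ≥0∞} (hp : 1 ≤ p) {F G : domain → ℂ} (hF : IsAnalytic F)
    (hG : IsAnalytic G) : hardyENorm p (F + G) ≤ hardyENorm p F + hardyENorm p G := by
  refine iSup_le fun r => ?_
  refine (eLpNorm_add_le (hF.aestronglyMeasurable r) (hG.aestronglyMeasurable r) hp).trans ?_
  exact add_le_add (le_iSup (fun r => eLpNorm (fun θ => F (dilate r θ)) p torusMeasure) r)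
    (le_iSup (fun r => eLpNorm (fun θ => G (dilate r θ)) p torusMeasure) r)

lemma hardyENorm_smul (p : ℝ≥0∞) (c : ℂ) (F : domain → ℂ) :
    hardyENorm p (c • F) = ‖c‖ₑ * hardyENorm p F := by
  simp only [hardyENorm, ENNReal.mul_iSup]
  refine iSup_congr fun r => ?_
  exact eLpNorm_const_smul c (fun θ => F (dilate r θ)) p torusMeasure

lemma torusMeasure_pos {U : Set Torus} (hU : IsOpen U) (hne : U.Nonempty) :
    torusMeasure U ≠ 0 := by
  obtain ⟨x, hx⟩ := hne
  obtain ⟨I, u, hu, hsub⟩ := isOpen_pi_iff.1 hU x hx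
  intro h0
  have h1 : torusMeasure ((I : Set ℕ).pi u) = 0 := measure_mono_null hsub h0
  rw [torusMeasure, Measure.infinitePi_pi _ (fun i hi => (hu i hi).1.measurableSet),
    Finset.prod_eq_zero_iff] at h1
  obtain ⟨i, hi, h⟩ := h1
  exact (hu i hi).1.measure_ne_zero _ ⟨x i, (hu i hi).2⟩ h

lemma eq_zero_on_torus {p : ℝ≥0∞} (hp : 1 ≤ p) {F : domain → ℂ} (hF : IsAnalytic F)
    (h : hardyENorm p F = 0) (r : Set.Ioo (0 : ℝ) 1) (θ : Torus) : F (dilate r θ) = 0 := by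
  have h1 : eLpNorm (fun θ => F (dilate r θ)) p torusMeasure = 0 := by
    simp only [hardyENorm, ENNReal.iSup_eq_zero] at h
    exact h r
  rw [eLpNorm_eq_zero_iff (hF.aestronglyMeasurable r) (zero_lt_one.trans_le hp).ne'] at h1
  by_contra hne
  have hopen : IsOpen {θ | F (dilate r θ) ≠ 0} :=
    isOpen_ne.preimage (hF.continuous.comp (continuous_dilate r))
  exact torusMeasure_pos hopen ⟨θ, hne⟩ h1

/-- The point whose first `J` coordinates are those of `ζ`, the others being those of `ξ`. -/
def mix (J : ℕ) (ζ ξ : domain) : domain :=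
  mkPoint (fun j => if j < J then (ζ : EllOne) j else (ξ : EllOne) j)
    (Summable.of_nonneg_of_le (fun _ => norm_nonneg _)
      (fun j => by
        split_ifs
        · exact le_add_of_nonneg_right (norm_nonneg ((ξ : EllOne) j))
        · exact le_add_of_nonneg_left (norm_nonneg ((ζ : EllOne) j)))
      ((EllOne.summable (ζ : EllOne)).add (EllOne.summable (ξ : EllOne))))
    (fun j => by
      split_ifs
      · exact ζ.2 j
      · exact ξ.2 j)

lemma mix_apply (J : ℕ) (ζ ξ : domain) (j : ℕ) :
    (mix J ζ ξ : EllOne) j = if j < J then (ζ : EllOne) j else (ξ : EllOne) j := rfl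

lemma dilate_apply (r : Set.Ioo (0 : ℝ) 1) (θ : Torus) (j : ℕ) : (dilate r θ : EllOne) j =
    ((r : ℝ) : ℂ) ^ (j + 1) * ((AddCircle.toCircle (θ j) : Circle) : ℂ) := rfl

lemma eq_zero_on_mix {F : domain → ℂ} (hF : IsAnalytic F) (r : Set.Ioo (0 : ℝ) 1)
    (h : ∀ θ, F (dilate r θ) = 0) (J : ℕ) : ∀ ζ θ, F (mix J ζ (dilate r θ)) = 0 := by
  induction J with
  | zero =>
    intro ζ θ
    have : mix 0 ζ (dilate r θ) = dilate r θ := by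
      apply Subtype.ext
      ext j
      simp [mix_apply]
    rw [this, h]
  | succ J ih =>
    intro ζ θ
    -- move the coordinate with index `J`
    set b : domain := mix J ζ (dilate r θ) with hb
    set η : EllOne := lp.single 1 J (1 : ℂ) with hη
    set c : EllOne := (b : EllOne) - ((b : EllOne) J) • η with hc
    have hcoord : ∀ (z : ℂ) (j : ℕ),
        (c + z • η) j = if j = J then z else (b : EllOne) j := by
      intro z j
      have hηj : η j = if j = J then 1 else 0 := by
        rw [hη, lp.single_apply, Pi.single_apply]
      change ((b : EllOne) j - (b : EllOne) J * η j) + z * η j = _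
      rw [hηj]
      by_cases hj : j = J
      · subst hj
        simp
      · simp [hj]
    have hbj : ∀ j, (b : EllOne) j =
        if j < J then (ζ : EllOne) j else (dilate r θ : EllOne) j := fun _ => rfl
    have hmem : ∀ z : ℂ, ‖z‖ < 1 → c + z • η ∈ domain := by
      intro z hz j
      rw [hcoord]
      split_ifs
      · exact hz
      · exact b.2 j
    have hcd : c ∈ domain := by simpa using hmem 0 (by simp)
    have han : AnalyticOnNhd ℂ (fun z : ℂ => extendZero F (c + z • η)) (Metric.ball 0 1) :=
      (hF.slice ⟨c, hcd⟩ η).mono fun z hz => hmem z (by simpa using hz)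
    -- the slice vanishes on a circle
    have hcirc : ∀ t : UnitAddCircle, extendZero F
        (c + (((r : ℝ) : ℂ) ^ (J + 1) * ((AddCircle.toCircle t : Circle) : ℂ)) • η) = 0 := by
      intro t
      have : c + (((r : ℝ) : ℂ) ^ (J + 1) * ((AddCircle.toCircle t : Circle) : ℂ)) • η =
          (mix J ζ (dilate r (Function.update θ J t)) : EllOne) := by
        ext j
        rw [hcoord, hbj, mix_apply, dilate_apply, dilate_apply]
        by_cases hj : j = J
        · subst hj
          simp
        · simp [hj]
      rw [this, extendZero_coe, ih]
    have hcirc' : ∀ z : ℂ, ‖z‖ = (r : ℝ) ^ (J + 1) → extendZero F (c + z • η) = 0 := by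
      intro z hz
      have hr : (0 : ℝ) < (r : ℝ) ^ (J + 1) := pow_pos r.2.1 _
      have hr' : (((r : ℝ) : ℂ) ^ (J + 1)) ≠ 0 :=
        pow_ne_zero _ (Complex.ofReal_ne_zero.2 r.2.1.ne')
      have hmemc : z / ((r : ℝ) : ℂ) ^ (J + 1) ∈ Submonoid.unitSphere ℂ := by
        rw [Submonoid.unitSphere, ← SetLike.mem_coe]
        change _ ∈ Metric.sphere (0 : ℂ) 1
        rw [mem_sphere_zero_iff_norm, norm_div, hz, norm_pow, Complex.norm_real,
          Real.norm_eq_abs, abs_of_pos r.2.1, div_self hr.ne']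
      obtain ⟨t, ht⟩ := (AddCircle.homeomorphCircle (one_ne_zero (α := ℝ))).surjective
        (⟨z / ((r : ℝ) : ℂ) ^ (J + 1), hmemc⟩ : Circle)
      rw [AddCircle.homeomorphCircle_apply] at ht
      have := hcirc t
      rw [ht] at this
      rwa [mul_div_cancel₀ _ hr'] at this
    have hzero : Set.EqOn (fun z : ℂ => extendZero F (c + z • η)) 0 (Metric.ball 0 1) := by
      have hρ0 : (0 : ℝ) < (r : ℝ) ^ (J + 1) := pow_pos r.2.1 _
      have hρ1 : (r : ℝ) ^ (J + 1) < 1 := pow_lt_one₀ r.2.1.le r.2.2 (Nat.succ_ne_zero J)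
      refine han.eqOn_of_preconnected_of_frequently_eq (analyticOnNhd_const (v := (0 : ℂ)))
        (convex_ball _ _).isPreconnected
        (z₀ := (((r : ℝ) ^ (J + 1) : ℝ) : ℂ)) ?_ ?_
      · simpa [abs_of_pos r.2.1] using hρ1
      · have hd : HasDerivAt (fun t : ℝ => (((r : ℝ) ^ (J + 1) : ℝ) : ℂ) *
            Complex.exp (((t : ℝ) : ℂ) * Complex.I))
            ((((r : ℝ) ^ (J + 1) : ℝ) : ℂ) * (Complex.exp (((0 : ℝ) : ℂ) * Complex.I) *
              (1 * Complex.I))) 0 :=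
          ((Complex.ofRealCLM.hasDerivAt.mul_const Complex.I).cexp).const_mul _
        have ht := hd.tendsto_nhdsNE (by
          simp [r.2.1.ne'])
        simp only [Complex.ofReal_zero, zero_mul, Complex.exp_zero, mul_one] at ht
        refine ht.frequently (Eventually.frequently (Eventually.of_forall fun t => ?_))
        refine hcirc' _ ?_
        rw [norm_mul, Complex.norm_exp_ofReal_mul_I, mul_one, Complex.norm_real,
          Real.norm_eq_abs, abs_of_pos hρ0]
    have hfin := hzero (x := (ζ : EllOne) J) (by simpa using ζ.2 J)
    have hpt : c + ((ζ : EllOne) J) • η = (mix (J + 1) ζ (dilate r θ) : EllOne) := by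
      ext j
      rw [hcoord, hbj, mix_apply]
      by_cases hj : j = J
      · subst hj
        simp
      · have : j < J + 1 ↔ j < J := by omega
        simp [hj, this]
    simpa only [hpt, extendZero_coe, Pi.zero_apply] using hfin

lemma tendsto_mix (ζ ξ : domain) : Tendsto (fun J => mix J ζ ξ) atTop (𝓝 ζ) := by
  rw [tendsto_iff_dist_tendsto_zero]
  have hs : Summable fun j => ‖(ξ : EllOne) j - (ζ : EllOne) j‖ :=
    EllOne.summable ((ξ : EllOne) - ζ)
  have hdist : ∀ J, dist (mix J ζ ξ) ζ =
      ∑' j, (if j < J then 0 else ‖(ξ : EllOne) j - (ζ : EllOne) j‖) := by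
    intro J
    rw [Subtype.dist_eq, dist_eq_norm, EllOne.norm_eq]
    refine tsum_congr fun j => ?_
    change ‖(mix J ζ ξ : EllOne) j - (ζ : EllOne) j‖ = _
    rw [mix_apply]
    split_ifs <;> simp
  simp only [hdist]
  have := tendsto_tsum_of_dominated_convergence (𝓕 := atTop)
    (f := fun (J : ℕ) j => if j < J then 0 else ‖(ξ : EllOne) j - (ζ : EllOne) j‖)
    (g := fun _ => (0 : ℝ)) hs (fun j => ?_) (Eventually.of_forall fun J j => ?_)
  · simpa using this
  · refine tendsto_const_nhds.congr' ?_
    filter_upwards [eventually_gt_atTop j] with J hJ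
    simp [hJ]
  · split_ifs <;> simp

lemma eq_zero_of_hardyENorm_eq_zero {p : ℝ≥0∞} (hp : 1 ≤ p) {F : domain → ℂ}
    (hF : IsAnalytic F) (h : hardyENorm p F = 0) : F = 0 := by
  funext ζ
  let r : Set.Ioo (0 : ℝ) 1 := ⟨1 / 2, by norm_num, by norm_num⟩
  have h1 := eq_zero_on_mix hF r (eq_zero_on_torus hp hF h r)
  have h2 := (hF.continuous.tendsto ζ).comp (tendsto_mix ζ (dilate r 0))
  simp only [Function.comp_def, h1] at h2
  exact (tendsto_nhds_unique h2 tendsto_const_nhds)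

/-! ### The Hardy space as a normed space -/

/-- The linear space of all analytic functions on the domain with finite Hardy norm. -/
def hardySubmodule (p : ℝ≥0∞) [hp : Fact (1 ≤ p)] : Submodule ℂ (domain → ℂ) where
  carrier := {F | MemHardy p F}
  add_mem' hF hG := ⟨hF.1.add hG.1,
    (hardyENorm_add_le hp.out hF.1 hG.1).trans_lt (ENNReal.add_lt_top.2 ⟨hF.2, hG.2⟩)⟩
  zero_mem' := ⟨IsAnalytic.zero, by simp [hardyENorm_zero]⟩
  smul_mem' c F hF := ⟨hF.1.smul c, by
    rw [hardyENorm_smul]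
    exact ENNReal.mul_lt_top enorm_lt_top hF.2⟩

/-- The Hardy space, as a type of its own, so that it carries the topology of the Hardy norm. -/
def HardySpace (p : ℝ≥0∞) [Fact (1 ≤ p)] : Type := hardySubmodule p

namespace HardySpace

variable {p : ℝ≥0∞} [Fact (1 ≤ p)]

/-- The underlying function on the domain. -/
def toFun (F : HardySpace p) : domain → ℂ := F.1

instance : CoeFun (HardySpace p) fun _ => domain → ℂ := ⟨toFun⟩

instance : AddCommGroup (HardySpace p) := inferInstanceAs (AddCommGroup (hardySubmodule p))

instance : Module ℂ (HardySpace p) := inferInstanceAs (Module ℂ (hardySubmodule p))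

instance : Norm (HardySpace p) := ⟨fun F => (hardyENorm p F).toReal⟩

lemma norm_def (F : HardySpace p) : ‖F‖ = (hardyENorm p F).toReal := rfl

lemma core : NormedSpace.Core ℂ (HardySpace p) where
  norm_nonneg _ := ENNReal.toReal_nonneg
  norm_smul c F := by
    have : hardyENorm p (c • F : HardySpace p) = ‖c‖ₑ * hardyENorm p F :=
      hardyENorm_smul p c F.1
    rw [norm_def, norm_def, this, ENNReal.toReal_mul, toReal_enorm]
  norm_triangle F G := by
    have h : hardyENorm p (F + G : HardySpace p) ≤ hardyENorm p F + hardyENorm p G :=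
      hardyENorm_add_le Fact.out F.2.1 G.2.1
    have hF : hardyENorm p F ≠ ∞ := F.2.2.ne
    have hG : hardyENorm p G ≠ ∞ := G.2.2.ne
    rw [norm_def, norm_def, norm_def, ← ENNReal.toReal_add hF hG]
    exact ENNReal.toReal_mono (ENNReal.add_lt_top.2 ⟨F.2.2, G.2.2⟩).ne h
  norm_eq_zero_iff F := by
    rw [norm_def, ENNReal.toReal_eq_zero_iff, or_iff_left (show hardyENorm p F ≠ ∞ from F.2.2.ne)]
    constructor
    · intro h
      exact Subtype.ext (eq_zero_of_hardyENorm_eq_zero Fact.out F.2.1 h)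
    · rintro rfl
      exact hardyENorm_zero p

instance : NormedAddCommGroup (HardySpace p) := NormedAddCommGroup.ofCore core

instance : NormedSpace ℂ (HardySpace p) := NormedSpace.ofCore core

end HardySpace

/-! ### Matrices on square-summable sequences -/

/-- The Hilbert space of square-summable complex sequences, indexed by the positive integers. -/
abbrev EllTwo : Type := lp (fun _ : ℕ+ => ℂ) 2

/-- The infinite matrix `K` is (the matrix, in the standard basis, of) a bounded linear operator on
the square-summable sequences. -/
def IsBoundedMatrix (K : ℕ+ → ℕ+ → ℝ) : Prop :=
  ∃ A : EllTwo →L[ℂ] EllTwo, ∀ m n, A (lp.single 2 n (1 : ℂ)) m = (K m n : ℂ)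

end InfHardy

end

/-!
The idea of the proof.

*Monomial expansions.* On a torus `|ζ_j| = r ^ j` the Fourier coefficient of an analytic `F` with
respect to the character `w ^ α(n)` is `a_n r ^ |n|`, where `|n|` is the weight `∑ j α_j` of the
factorization `n = ∏ p_j ^ α_j` and `a_n` does not depend on `r`: by Cauchy's theorem in one variable one may change the radii coordinate by coordinate, and a limit
changes them all (`integral_dilate_eq`). Coefficients with a negative exponent vanish
(`integral_dilate_eq_zero`). Bessel's inequality, with `r → 1`, gives `∑ |a_n|² ≤ ‖F‖²`.
The monomials are absolutely summable at every point of the domain, by the Euler product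
`∑ |ζ ^ α(n)| = ∏ (1 - |ζ_j|)⁻¹`, locally boundedly in `ζ`; hence a series of monomials with bounded
coefficients is analytic and is the monomial expansion of its sum, uniformity on compact sets being
Dini's theorem (`hasMonomialExpansion_monomialSum`). Finally `F - ∑ a_n ζ ^ α(n)` has no nonzero
Fourier coefficient on any torus, and vanishes because trigonometric polynomials are dense among the
continuous functions (`MemHardy.hasMonomialExpansion`).

*Random series.* Let `q = max p 2`. The Hardy norm of a polynomial `∑ a_n X_n ζ ^ α(n)` is at most
its norm in `L ^ p`, hence in `L ^ q`, of the torus, by the maximum principle for functions with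
values in `L ^ p` (`eLpNorm_polynomial_dilate_le`). At each point of the torus the real and
imaginary parts of the polynomial are Gaussian, with variance controlled by the covariance operator,
so their moments of order `q` are bounded by their second moments; Fubini's theorem then bounds the
second moment of the Hardy norm by a constant times `∑ |a_n|²` (`eLpNorm_random_polynomial_le`).
Fatou's lemma carries the estimate over to infinite series and shows that the partial sums converge
in probability in the Hardy norm, which also makes the sum strongly measurable
(`memHardy_random_series`).
-/

noncomputable section

namespace InfHardy

/-! ### Monomials -/

lemma monomial_one (ζ : ℕ → ℂ) : monomial 1 ζ = 1 := by simp [monomial]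

lemma monomial_mul (m n : ℕ+) (ζ : ℕ → ℂ) :
    monomial (m * n) ζ = monomial m ζ * monomial n ζ := by
  rw [monomial, PNat.mul_coe, Nat.factorization_mul m.ne_zero n.ne_zero,
    Finsupp.prod_add_index' (fun _ => pow_zero _) (fun _ _ _ => pow_add _ _ _)]
  rfl

lemma monomial_mul_apply (n : ℕ+) (ζ ξ : ℕ → ℂ) :
    monomial n (fun j => ζ j * ξ j) = monomial n ζ * monomial n ξ := by
  simp only [monomial, Finsupp.prod, mul_pow, Finset.prod_mul_distrib]

lemma monomial_prime (p : ℕ+) (hp : (p : ℕ).Prime) (ζ : ℕ → ℂ) :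
    monomial p ζ = ζ (Nat.primeCounting' p) := by
  rw [monomial, hp.factorization,
    Finsupp.prod_single_index (h := fun q k => ζ (Nat.primeCounting' q) ^ k) (pow_zero _), pow_one]

lemma norm_monomial (n : ℕ+) (ζ : ℕ → ℂ) :
    ‖monomial n ζ‖ = (n : ℕ).factorization.prod fun q k => ‖ζ (Nat.primeCounting' q)‖ ^ k := by
  simp only [monomial, Finsupp.prod, norm_prod, norm_pow]

lemma norm_monomial_mono (n : ℕ+) {ζ ξ : ℕ → ℂ} (h : ∀ j, ‖ζ j‖ ≤ ‖ξ j‖) :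
    ‖monomial n ζ‖ ≤ ‖monomial n ξ‖ := by
  rw [norm_monomial, norm_monomial]
  exact Finset.prod_le_prod (fun _ _ => by positivity)
    fun _ _ => pow_le_pow_left₀ (norm_nonneg _) (h _) _

lemma monomial_ne_zero (n : ℕ+) {ζ : ℕ → ℂ} (h : ∀ j, ζ j ≠ 0) : monomial n ζ ≠ 0 := by
  unfold monomial Finsupp.prod
  exact Finset.prod_ne_zero_iff.2 fun _ _ => pow_ne_zero _ (h _)

lemma norm_monomial_eq_one (n : ℕ+) {ζ : ℕ → ℂ} (h : ∀ j, ‖ζ j‖ = 1) : ‖monomial n ζ‖ = 1 := by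
  simp [norm_monomial, h]

lemma continuous_monomial_comp {Y : Type*} [TopologicalSpace Y] {u : Y → ℕ → ℂ}
    (hu : ∀ j, Continuous fun y => u y j) (n : ℕ+) : Continuous fun y => monomial n (u y) := by
  unfold monomial Finsupp.prod
  exact continuous_finsetProd _ fun _ _ => (hu _).pow _

lemma differentiable_monomial_comp {u : ℂ → ℕ → ℂ}
    (hu : ∀ j, Differentiable ℂ fun z => u z j) (n : ℕ+) :
    Differentiable ℂ fun z => monomial n (u z) := by
  unfold monomial Finsupp.prod
  exact Differentiable.fun_finsetProd fun _ _ => (hu _).pow _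

/-- The absolute value of a monomial, as a completely multiplicative function of the index,
extended by zero to the index zero. -/
def normMonomialHom (ζ : ℕ → ℂ) : ℕ →* ℝ where
  toFun n := if h : 0 < n then ‖monomial ⟨n, h⟩ ζ‖ else 0
  map_one' := by
    have := monomial_one ζ
    simp only [zero_lt_one, dif_pos]
    exact (congrArg norm this).trans norm_one
  map_mul' m n := by
    rcases m.eq_zero_or_pos with rfl | hm
    · simp
    rcases n.eq_zero_or_pos with rfl | hn
    · simp
    rw [dif_pos (Nat.mul_pos hm hn), dif_pos hm, dif_pos hn, ← norm_mul]
    exact congrArg norm (monomial_mul ⟨m, hm⟩ ⟨n, hn⟩ ζ)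

lemma normMonomialHom_coe (ζ : ℕ → ℂ) (n : ℕ+) : normMonomialHom ζ n = ‖monomial n ζ‖ :=
  dif_pos n.pos

/-- Summability of the monomials, in the quantitative form given by the Euler product
`∑ ‖ζ ^ α(n)‖ = ∏ (1 - ‖ζ_j‖)⁻¹`. -/
lemma sum_norm_monomial_le {ζ : ℕ → ℂ} {c : ℝ} (hc : c < 1) (h : ∀ j, ‖ζ j‖ ≤ c)
    (hs : Summable fun j => ‖ζ j‖) (s : Finset ℕ+) :
    ∑ n ∈ s, ‖monomial n ζ‖ ≤ Real.exp ((∑' j, ‖ζ j‖) / (1 - c)) := by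
  have hc0 : 0 < 1 - c := sub_pos.2 hc
  have hprime : ∀ {q : ℕ}, q.Prime → normMonomialHom ζ q = ‖ζ (Nat.primeCounting' q)‖ := by
    intro q hq
    exact (normMonomialHom_coe ζ ⟨q, hq.pos⟩).trans
      (congrArg norm (monomial_prime ⟨q, hq.pos⟩ hq ζ))
  set N : ℕ := s.sup (fun n => (n : ℕ)) + 1 with hN
  have hsum := (EulerProduct.summable_and_hasSum_smoothNumbers_prod_primesBelow_geometric
    (f := normMonomialHom ζ) (fun {q} hq => by
      rw [hprime hq, norm_norm]
      exact (h _).trans_lt hc) N).2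
  have hmem : ∀ n ∈ s, (n : ℕ) ∈ N.smoothNumbers := fun n hn =>
    Nat.mem_smoothNumbers_of_lt n.pos
      (Nat.lt_succ_of_le (Finset.le_sup (f := fun n : ℕ+ => (n : ℕ)) hn))
  let e : {n // n ∈ s} ↪ N.smoothNumbers :=
    ⟨fun n => ⟨n.1, hmem n.1 n.2⟩, fun m n hmn => Subtype.ext (PNat.coe_injective
      (by simpa using hmn))⟩
  have h1 : ∑ n ∈ s, ‖monomial n ζ‖ = ∑ m ∈ s.attach.map e, normMonomialHom ζ m := by
    rw [Finset.sum_map, ← Finset.sum_attach]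
    exact Finset.sum_congr rfl fun n _ => (normMonomialHom_coe ζ n.1).symm
  have hnn : ∀ m, 0 ≤ normMonomialHom ζ m := by
    intro m
    change 0 ≤ dite _ _ _
    split_ifs
    · exact norm_nonneg _
    · exact le_rfl
  rw [h1]
  refine (sum_le_hasSum (f := fun m : N.smoothNumbers => normMonomialHom ζ m) _
    (fun m _ => hnn m) hsum).trans ?_
  have h2 : ∀ q ∈ N.primesBelow, (1 - normMonomialHom ζ q)⁻¹ ≤
      Real.exp (‖ζ (Nat.primeCounting' q)‖ / (1 - c)) := by
    intro q hq
    rw [hprime (Nat.prime_of_mem_primesBelow hq)]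
    set x := ‖ζ (Nat.primeCounting' q)‖
    have hx0 : 0 ≤ x := norm_nonneg _
    have hx : 1 - c ≤ 1 - x := sub_le_sub_left (h _) 1
    have hx1 : 0 < 1 - x := hc0.trans_le hx
    calc (1 - x)⁻¹ = x / (1 - x) + 1 := by field_simp; ring
      _ ≤ x / (1 - c) + 1 := by gcongr
      _ ≤ _ := Real.add_one_le_exp _
  refine (Finset.prod_le_prod (fun q hq => ?_) h2).trans ?_
  · rw [hprime (Nat.prime_of_mem_primesBelow hq)]
    exact inv_nonneg.2 (sub_nonneg.2 ((h _).trans hc.le))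
  rw [← Real.exp_sum, Real.exp_le_exp, ← Finset.sum_div]
  gcongr
  have hinj : Set.InjOn Nat.primeCounting' (N.primesBelow : Set ℕ) := fun p hp q hq hpq =>
    Nat.count_injective (Nat.prime_of_mem_primesBelow hp) (Nat.prime_of_mem_primesBelow hq) hpq
  rw [← Finset.sum_image (f := fun j => ‖ζ j‖) hinj]
  exact hs.sum_le_tsum _ fun _ _ => norm_nonneg _

/-- Every point of the domain stays uniformly away from the boundary, as the domain is open. -/
lemma exists_margin (ζ : domain) : ∃ δ : ℝ, 0 < δ ∧ ∀ j, ‖(ζ : EllOne) j‖ + δ ≤ 1 := by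
  obtain ⟨ε, hε, hball⟩ := Metric.isOpen_iff.1 isOpen_domain ζ ζ.2
  refine ⟨ε / 2, half_pos hε, fun j => ?_⟩
  -- push the coordinate `j` outwards by `ε / 2`
  obtain ⟨u, hu, hu'⟩ : ∃ u : ℂ, ‖u‖ = 1 ∧ (ζ : EllOne) j = ‖(ζ : EllOne) j‖ * u := by
    by_cases h0 : (ζ : EllOne) j = 0
    · exact ⟨1, norm_one, by simp [h0]⟩
    · have h0' : (‖(ζ : EllOne) j‖ : ℂ) ≠ 0 := by simpa using h0
      exact ⟨(ζ : EllOne) j / ‖(ζ : EllOne) j‖, by simp [h0], by field_simp⟩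
  have hmem := hball (a := (ζ : EllOne) + lp.single 1 j (((ε / 2 : ℝ) : ℂ) * u)) (by
    rw [Metric.mem_ball, dist_eq_norm, add_sub_cancel_left, lp.norm_single one_pos, norm_mul, hu,
      mul_one, Complex.norm_real, Real.norm_eq_abs, abs_of_pos (half_pos hε)]
    exact half_lt_self hε) j
  have h1 : ((ζ : EllOne) + lp.single 1 j (((ε / 2 : ℝ) : ℂ) * u) : EllOne) j =
      ((‖(ζ : EllOne) j‖ + ε / 2 : ℝ) : ℂ) * u := by
    change (ζ : EllOne) j + (lp.single 1 j (((ε / 2 : ℝ) : ℂ) * u) : EllOne) j = _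
    rw [lp.single_apply_self, Complex.ofReal_add, add_mul, ← hu']
  rw [h1, norm_mul, hu, mul_one, Complex.norm_real, Real.norm_eq_abs,
    abs_of_nonneg (by positivity)] at hmem
  exact hmem.le

lemma summable_norm_monomial (ζ : domain) : Summable fun n => ‖monomial n (ζ : EllOne)‖ := by
  obtain ⟨δ, hδ, h⟩ := exists_margin ζ
  exact summable_of_sum_le (fun _ => norm_nonneg _)
    (sum_norm_monomial_le (c := 1 - δ) (by linarith) (fun j => by linarith [h j])
      (EllOne.summable ζ))

lemma eventually_sum_norm_monomial_le (ζ : domain) : ∃ B : ℝ, ∀ᶠ ξ : domain in 𝓝 ζ,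
    ∑' n, ‖monomial n (ξ : EllOne)‖ ≤ B := by
  obtain ⟨δ, hδ, h⟩ := exists_margin ζ
  refine ⟨Real.exp ((‖(ζ : EllOne)‖ + δ / 2) / (1 - (1 - δ / 2))), ?_⟩
  filter_upwards [Metric.ball_mem_nhds ζ (half_pos hδ)] with ξ hξ
  have hd : ‖(ξ : EllOne) - ζ‖ < δ / 2 := by
    rwa [Metric.mem_ball, Subtype.dist_eq, dist_eq_norm] at hξ
  refine (summable_norm_monomial ξ).tsum_le_of_sum_le fun s =>
    (sum_norm_monomial_le (c := 1 - δ / 2) (by linarith) (fun j => ?_)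
      (EllOne.summable ξ) s).trans ?_
  · have h1 : ‖((ξ : EllOne) - ζ) j‖ ≤ ‖(ξ : EllOne) - ζ‖ := EllOne.norm_apply_le _ j
    have h2 : ‖(ξ : EllOne) j‖ ≤ ‖(ζ : EllOne) j‖ + ‖((ξ : EllOne) - ζ) j‖ := by
      have : (ξ : EllOne) j = (ζ : EllOne) j + ((ξ : EllOne) - ζ) j := by simp
      calc ‖(ξ : EllOne) j‖ = ‖(ζ : EllOne) j + ((ξ : EllOne) - ζ) j‖ := by rw [← this]
        _ ≤ _ := norm_add_le _ _
    linarith [h j]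
  · rw [← EllOne.norm_eq]
    have : ‖(ξ : EllOne)‖ ≤ ‖(ζ : EllOne)‖ + ‖(ξ : EllOne) - ζ‖ := by
      simpa using norm_add_le (ζ : EllOne) ((ξ : EllOne) - ζ)
    have h3 : (0 : ℝ) < 1 - (1 - δ / 2) := by linarith
    gcongr
    linarith

/-! ### Series of monomials with bounded coefficients -/

/-- The sum of the series `∑ a_n ζ ^ α(n)`. -/
def monomialSum (a : ℕ+ → ℂ) (ζ : domain) : ℂ := ∑' n, a n * monomial n (ζ : EllOne)

section Bounded

variable {a : ℕ+ → ℂ} {C : ℝ}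

lemma norm_coeff_mul_monomial_le (ha : ∀ n, ‖a n‖ ≤ C) (n : ℕ+) (ζ : ℕ → ℂ) :
    ‖a n * monomial n ζ‖ ≤ C * ‖monomial n ζ‖ := by
  rw [norm_mul]
  exact mul_le_mul_of_nonneg_right (ha n) (norm_nonneg _)

lemma summable_norm_coeff_mul_monomial (ha : ∀ n, ‖a n‖ ≤ C) (ζ : domain) :
    Summable fun n => ‖a n * monomial n (ζ : EllOne)‖ :=
  Summable.of_nonneg_of_le (fun _ => norm_nonneg _)
    (fun n => norm_coeff_mul_monomial_le ha n _) ((summable_norm_monomial ζ).mul_left C)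

lemma isAnalytic_monomialSum (ha : ∀ n, ‖a n‖ ≤ C) : IsAnalytic (monomialSum a) where
  locally_bounded ζ := by
    obtain ⟨B, hB⟩ := eventually_sum_norm_monomial_le ζ
    refine ⟨C * B, hB.mono fun ξ hξ => ?_⟩
    refine (norm_tsum_le_tsum_norm (summable_norm_coeff_mul_monomial ha ξ)).trans ?_
    refine ((summable_norm_coeff_mul_monomial ha ξ).tsum_le_tsum
      (fun n => norm_coeff_mul_monomial_le ha n _) ((summable_norm_monomial ξ).mul_left C)).trans ?_
    rw [tsum_mul_left]
    exact mul_le_mul_of_nonneg_left hξ ((norm_nonneg _).trans (ha 1))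
  slice ζ η := by
    have hopen : IsOpen {z : ℂ | (ζ : EllOne) + z • η ∈ domain} :=
      isOpen_domain.preimage (by fun_prop)
    refine DifferentiableOn.analyticOnNhd (fun z₀ hz₀ => ?_) hopen
    obtain ⟨δ, hδ, h⟩ := exists_margin ⟨(ζ : EllOne) + z₀ • η, hz₀⟩
    -- near `z₀` the slice is dominated by a single point of the domain
    set ε : ℝ := δ / (2 * (‖η‖ + 1)) with hε
    have hη : 0 < ‖η‖ + 1 := by positivity
    have hε0 : 0 < ε := by positivity
    have hεη : ∀ j, ε * ‖η j‖ < δ := fun j => by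
      have h1 : ‖η j‖ ≤ ‖η‖ + 1 := (EllOne.norm_apply_le η j).trans (by linarith)
      calc ε * ‖η j‖ ≤ ε * (‖η‖ + 1) := by gcongr
        _ = δ / 2 := by rw [hε]; field_simp
        _ < δ := half_lt_self hδ
    let f : ℕ → ℂ := fun j => ((‖((ζ : EllOne) + z₀ • η) j‖ + ε * ‖η j‖ : ℝ) : ℂ)
    have hf : ∀ j, ‖f j‖ = ‖((ζ : EllOne) + z₀ • η) j‖ + ε * ‖η j‖ := fun j => by
      rw [Complex.norm_real, Real.norm_eq_abs, abs_of_nonneg (by positivity)]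
    let M : domain := mkPoint f
      (by simpa only [hf] using (EllOne.summable _).add ((EllOne.summable η).mul_left ε))
      (fun j => by
        rw [hf]
        have := h j
        have := hεη j
        dsimp only at *
        linarith)
    have hdom : ∀ z ∈ Metric.ball z₀ ε, ∀ j, ‖((ζ : EllOne) + z • η) j‖ ≤ ‖(M : EllOne) j‖ := by
      intro z hz j
      change _ ≤ ‖f j‖
      rw [hf]
      have h1 : ((ζ : EllOne) + z • η) j = ((ζ : EllOne) + z₀ • η) j + (z - z₀) * η j := by
        change (ζ : EllOne) j + z * η j = (ζ : EllOne) j + z₀ * η j + (z - z₀) * η j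
        ring
      rw [h1]
      refine (norm_add_le _ _).trans ?_
      rw [norm_mul]
      rw [Metric.mem_ball, dist_eq_norm] at hz
      gcongr
    have hd : DifferentiableOn ℂ
        (fun z : ℂ => ∑' n, a n * monomial n ((ζ : EllOne) + z • η : EllOne))
        (Metric.ball z₀ ε) := by
      refine Complex.differentiableOn_tsum_of_summable_norm
        (u := fun n => C * ‖monomial n (M : EllOne)‖)
        ((summable_norm_monomial M).mul_left C) (fun n => ?_) Metric.isOpen_ball
        (fun n z hz => ?_)
      · refine (Differentiable.const_mul (differentiable_monomial_comp (fun j => ?_) n)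
          _).differentiableOn
        change Differentiable ℂ fun z : ℂ => (ζ : EllOne) j + z * η j
        fun_prop
      · refine (norm_coeff_mul_monomial_le ha n _).trans ?_
        exact mul_le_mul_of_nonneg_left (norm_monomial_mono n (hdom z hz))
          ((norm_nonneg _).trans (ha 1))
    have hd' := hd.differentiableAt (Metric.ball_mem_nhds z₀ hε0)
    refine (hd'.congr_of_eventuallyEq ?_).differentiableWithinAt
    filter_upwards [hopen.mem_nhds hz₀] with z hz
    rw [extendZero_of_mem _ hz]
    rfl

/-- The point of the domain whose coordinates are the absolute values of those of `ζ`. -/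
def absPoint (ζ : domain) : domain :=
  mkPoint (fun j => ((‖(ζ : EllOne) j‖ : ℝ) : ℂ))
    (by simpa using EllOne.summable (ζ : EllOne)) (fun j => by simpa using ζ.2 j)

lemma continuous_absPoint : Continuous absPoint := by
  refine (LipschitzWith.of_dist_le_mul (K := 1) fun ζ ξ => ?_).continuous
  rw [NNReal.coe_one, one_mul, Subtype.dist_eq, Subtype.dist_eq, dist_eq_norm, dist_eq_norm,
    EllOne.norm_eq, EllOne.norm_eq]
  refine (EllOne.summable _).tsum_le_tsum (fun j => ?_) (EllOne.summable _)
  change ‖((‖(ζ : EllOne) j‖ : ℝ) : ℂ) - ((‖(ξ : EllOne) j‖ : ℝ) : ℂ)‖ ≤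
    ‖(ζ : EllOne) j - (ξ : EllOne) j‖
  rw [← Complex.ofReal_sub, Complex.norm_real]
  exact abs_norm_sub_norm_le _ _

lemma monomial_absPoint (n : ℕ+) (ζ : domain) :
    monomial n (absPoint ζ : EllOne) = ((‖monomial n (ζ : EllOne)‖ : ℝ) : ℂ) := by
  rw [norm_monomial, Finsupp.prod, Complex.ofReal_prod]
  simp only [Complex.ofReal_pow]
  rfl

/-- The sum of the absolute values is continuous because it is the restriction of an analytic
function to the points with nonnegative coordinates. -/
lemma continuous_tsum_norm (ha : ∀ n, ‖a n‖ ≤ C) :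
    Continuous fun ζ : domain => ∑' n, ‖a n * monomial n (ζ : EllOne)‖ := by
  have h1 : IsAnalytic (monomialSum fun n => ((‖a n‖ : ℝ) : ℂ)) :=
    isAnalytic_monomialSum (C := C) fun n => by simpa using ha n
  have h2 := Complex.continuous_re.comp (h1.continuous.comp continuous_absPoint)
  refine h2.congr fun ζ => ?_
  have : monomialSum (fun n => ((‖a n‖ : ℝ) : ℂ)) (absPoint ζ) =
      ((∑' n, ‖a n * monomial n (ζ : EllOne)‖ : ℝ) : ℂ) := by
    rw [Complex.ofReal_tsum]
    exact tsum_congr fun n => by rw [monomial_absPoint, norm_mul, Complex.ofReal_mul]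
  simp only [Function.comp_apply, this, Complex.ofReal_re]

lemma continuous_coe_apply (j : ℕ) : Continuous fun ζ : domain => (ζ : EllOne) j := by
  refine (LipschitzWith.of_dist_le_mul (K := 1) fun ζ ξ => ?_).continuous
  rw [NNReal.coe_one, one_mul, Subtype.dist_eq, dist_eq_norm, dist_eq_norm]
  exact EllOne.norm_apply_le ((ζ : EllOne) - ξ) j

lemma hasMonomialExpansion_monomialSum (ha : ∀ n, ‖a n‖ ≤ C) :
    HasMonomialExpansion (monomialSum a) a where
  hasSum ζ := (summable_norm_coeff_mul_monomial ha ζ).of_norm.hasSum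
  summable_norm := summable_norm_coeff_mul_monomial ha
  uniform K hK := by
    refine Monotone.tendstoUniformlyOn_of_forall_tendsto hK (fun s => ?_) (fun ζ _ s t hst => ?_)
      (continuous_tsum_norm ha).continuousOn
      (fun ζ _ => (summable_norm_coeff_mul_monomial ha ζ).hasSum)
    · refine (continuous_finsetSum _ fun n _ => ?_).continuousOn
      exact (continuous_const.mul (continuous_monomial_comp continuous_coe_apply n)).norm
    · exact Finset.sum_le_sum_of_subset_of_nonneg hst fun _ _ _ => norm_nonneg _

end Bounded

/-! ### Characters of the infinite torus -/

/-- The point of the infinite torus with the given angles, as a sequence of complex numbers. -/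
def torusPoint (θ : Torus) (j : ℕ) : ℂ := (AddCircle.toCircle (θ j) : Circle)

/-- The character `w ↦ w ^ α(n)` of the infinite torus. -/
def torusChar (n : ℕ+) (θ : Torus) : ℂ := monomial n (torusPoint θ)

/-- The exponent, in the factorization of `n`, of the prime with zero-based index `j`. -/
def exponent (j : ℕ) (n : ℕ+) : ℕ := (n : ℕ).factorization (Nat.nth Nat.Prime j)

/-- The value of the monomial with index `n` at `(r, r ^ 2, r ^ 3, …)`. -/
def radialWeight (r : ℝ) (n : ℕ+) : ℂ := monomial n fun j => (r : ℂ) ^ (j + 1)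

instance : IsProbabilityMeasure torusMeasure := by unfold torusMeasure; infer_instance

lemma torusPoint_add (θ τ : Torus) (j : ℕ) :
    torusPoint (θ + τ) j = torusPoint θ j * torusPoint τ j := by
  simp [torusPoint, AddCircle.toCircle_add]

lemma norm_torusPoint (θ : Torus) (j : ℕ) : ‖torusPoint θ j‖ = 1 := Circle.norm_coe _

lemma continuous_torusPoint (j : ℕ) : Continuous fun θ : Torus => torusPoint θ j :=
  continuous_subtype_val.comp (AddCircle.continuous_toCircle.comp (continuous_apply j))

lemma torusPoint_single (J : ℕ) (t : UnitAddCircle) (j : ℕ) :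
    torusPoint (Pi.single J t) j = if j = J then ((AddCircle.toCircle t : Circle) : ℂ) else 1 := by
  by_cases h : j = J
  · subst h
    simp [torusPoint]
  · simp [torusPoint, h, AddCircle.toCircle_zero]

lemma torusChar_add (n : ℕ+) (θ τ : Torus) :
    torusChar n (θ + τ) = torusChar n θ * torusChar n τ := by
  rw [torusChar, funext (torusPoint_add θ τ), monomial_mul_apply]
  rfl

lemma torusChar_mul (m n : ℕ+) (θ : Torus) :
    torusChar (m * n) θ = torusChar m θ * torusChar n θ := monomial_mul m n _

lemma norm_torusChar (n : ℕ+) (θ : Torus) : ‖torusChar n θ‖ = 1 :=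
  norm_monomial_eq_one n (norm_torusPoint θ)

lemma continuous_torusChar (n : ℕ+) : Continuous (torusChar n) :=
  continuous_monomial_comp continuous_torusPoint n

lemma monomial_dilate (n : ℕ+) (r : Set.Ioo (0 : ℝ) 1) (θ : Torus) :
    monomial n (dilate r θ : EllOne) = radialWeight r n * torusChar n θ :=
  monomial_mul_apply n _ _

lemma radialWeight_ne_zero {r : ℝ} (hr : r ≠ 0) (n : ℕ+) : radialWeight r n ≠ 0 :=
  monomial_ne_zero n fun _ => pow_ne_zero _ (Complex.ofReal_ne_zero.2 hr)

lemma monomial_single (n : ℕ+) (J : ℕ) (z : ℂ) :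
    monomial n (fun j => if j = J then z else 1) = z ^ exponent J n := by
  have hJ : (Nat.nth Nat.Prime J).Prime := Nat.prime_nth_prime J
  have hcount : Nat.primeCounting' (Nat.nth Nat.Prime J) = J :=
    Nat.count_nth_of_infinite Nat.infinite_setOfPred_prime J
  unfold monomial Finsupp.prod
  dsimp only
  rw [Finset.prod_eq_single (Nat.nth Nat.Prime J)]
  · rw [if_pos hcount]
    rfl
  · intro q hq hne
    have hqp : q.Prime := Nat.prime_of_mem_primeFactors hq
    rw [if_neg, one_pow]
    intro h
    exact hne (Nat.count_injective hqp hJ (h.trans hcount.symm))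
  · intro h
    rw [Finsupp.notMem_support_iff.1 h, pow_zero]

lemma torusChar_single (n : ℕ+) (J : ℕ) (t : UnitAddCircle) :
    torusChar n (Pi.single J t) = ((AddCircle.toCircle t : Circle) : ℂ) ^ exponent J n := by
  rw [torusChar, funext (torusPoint_single J t), monomial_single]

lemma dvd_of_exponent_le {m n : ℕ+} (h : ∀ J, exponent J m ≤ exponent J n) : m ∣ n := by
  rw [PNat.dvd_iff, ← Nat.factorization_le_iff_dvd m.ne_zero n.ne_zero]
  intro q
  by_cases hq : q.Prime
  · have := h (Nat.primeCounting' q)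
    rwa [exponent, exponent, Nat.primeCounting', Nat.nth_count hq] at this
  · rw [Nat.factorization_eq_zero_of_not_prime _ hq]
    exact Nat.zero_le _

lemma measurePreserving_add_torus (τ : Torus) :
    MeasurePreserving (fun θ : Torus => θ + τ) torusMeasure torusMeasure where
  measurable := measurable_pi_lambda _ fun j => (measurable_pi_apply j).add_const _
  map_eq := by
    have h := Measure.infinitePi_map_pi
      (μ := fun _ : ℕ => (AddCircle.haarAddCircle : Measure UnitAddCircle))
      (f := fun j (x : UnitAddCircle) => x + τ j) (fun j => measurable_add_const _)
    refine h.trans ?_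
    rw [torusMeasure]
    congr 1
    funext j
    exact map_add_right_eq_self _ _

lemma integral_add_torus (τ : Torus) (H : Torus → ℂ) :
    ∫ θ, H (θ + τ) ∂torusMeasure = ∫ θ, H θ ∂torusMeasure :=
  (measurePreserving_add_torus τ).integral_comp
    (MeasurableEquiv.addRight τ).measurableEmbedding H

lemma integrable_of_continuous {H : Torus → ℂ} (hH : Continuous H) : Integrable H torusMeasure := by
  rw [← integrableOn_univ]
  exact hH.continuousOn.integrableOn_compact isCompact_univ

/-- Averaging over the rotations of one coordinate. -/
lemma integral_rotate {H : Torus → ℂ} (hH : Continuous H) (J : ℕ) :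
    ∫ θ, H θ ∂torusMeasure =
      ∫ θ, ∫ t, H (θ + Pi.single J t) ∂AddCircle.haarAddCircle ∂torusMeasure := by
  have hc : Continuous (Function.uncurry fun (θ : Torus) (t : UnitAddCircle) =>
      H (θ + Pi.single J t)) :=
    hH.comp (continuous_fst.add ((continuous_single J).comp continuous_snd))
  rw [integral_integral_swap]
  · simp only [integral_add_torus, integral_const, probReal_univ, one_smul]
  · rw [← integrableOn_univ]
    exact hc.continuousOn.integrableOn_compact isCompact_univ

lemma integral_eq_zero_of_add {H : Torus → ℂ} {τ : Torus} {c : ℂ} (hc : c ≠ 1)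
    (h : ∀ θ, H (θ + τ) = c * H θ) : ∫ θ, H θ ∂torusMeasure = 0 := by
  have h1 := integral_add_torus τ H
  simp only [h, integral_const_mul] at h1
  by_contra h2
  exact hc ((mul_eq_right₀ h2).1 h1)

lemma toCircle_pow (t : UnitAddCircle) (k : ℕ) :
    ((AddCircle.toCircle t : Circle) : ℂ) ^ k = fourier (k : ℤ) t := by
  rw [fourier_apply, natCast_zsmul, AddCircle.toCircle_nsmul, Circle.coe_pow]

/-- Distinct characters are orthogonal: a suitable rotation of one coordinate changes the sign of
the integrand. -/
lemma torusChar_orthogonal {m n : ℕ+} (hmn : m ≠ n) :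
    ∫ θ, (starRingEnd ℂ) (torusChar n θ) * torusChar m θ ∂torusMeasure = 0 := by
  obtain ⟨J, hJ⟩ : ∃ J, exponent J m ≠ exponent J n := by
    by_contra! h
    exact hmn (PNat.dvd_antisymm (dvd_of_exponent_le fun J => (h J).le)
      (dvd_of_exponent_le fun J => (h J).ge))
  have hk : (-(exponent J n : ℤ) + exponent J m) ≠ 0 := by omega
  obtain ⟨t, ht⟩ : ∃ t : UnitAddCircle, fourier (-(exponent J n : ℤ) + exponent J m) t = -1 := by
    have := fourier_add_half_inv_index hk (zero_lt_one (α := ℝ)) 0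
    rw [fourier_eval_zero] at this
    exact ⟨_, this⟩
  refine integral_eq_zero_of_add (τ := Pi.single J t) (c := -1) (by norm_num) fun θ => ?_
  rw [torusChar_add, torusChar_add, torusChar_single, torusChar_single, map_mul, toCircle_pow,
    toCircle_pow, ← fourier_neg, ← ht, fourier_add]
  ring

/-! ### Fourier coefficients on circles -/

/-- Integrals over the unit circle group as circle integrals. -/
lemma integral_circle_eq (g : ℂ → ℂ) {s : ℝ} (hs : 0 < s) :
    ∫ t : UnitAddCircle, g (s * (AddCircle.toCircle t : Circle)) ∂AddCircle.haarAddCircle =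
      (2 * Real.pi * Complex.I)⁻¹ * ∮ z in C(0, s), (z - 0)⁻¹ • g z := by
  have h0 := AddCircle.intervalIntegral_preimage (1 : ℝ) 0
    (fun t => g (s * (AddCircle.toCircle t : Circle)))
  rw [AddCircle.integral_haarAddCircle, inv_one, one_smul, ← h0]
  have h1 : ∀ x : ℝ, g (s * ((AddCircle.toCircle (x : UnitAddCircle) : Circle) : ℂ)) =
      (fun θ : ℝ => g (s * Complex.exp (θ * Complex.I))) (2 * Real.pi * x) := fun x => by
    simp [AddCircle.toCircle_apply_mk]
  have h3 := intervalIntegral.integral_comp_mul_left (a := 0) (b := 0 + 1)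
    (fun θ : ℝ => g (s * Complex.exp (θ * Complex.I))) (c := 2 * Real.pi) (by positivity)
  rw [intervalIntegral.integral_congr (fun x _ => h1 x), h3, circleIntegral]
  have h2 : ∀ θ : ℝ, deriv (circleMap 0 s) θ • ((circleMap 0 s θ - 0)⁻¹ • g (circleMap 0 s θ)) =
      Complex.I * g (s * Complex.exp (θ * Complex.I)) := fun θ => by
    have hne : circleMap 0 s θ ≠ 0 := circleMap_ne_center hs.ne'
    rw [deriv_circleMap, sub_zero, smul_eq_mul, smul_eq_mul, ← circleMap_zero s θ]
    generalize g (circleMap 0 s θ) = y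
    field_simp
  simp only [h2, intervalIntegral.integral_const_mul]
  have hpi : (Real.pi : ℂ) ≠ 0 := Complex.ofReal_ne_zero.2 Real.pi_ne_zero
  simp only [zero_add, mul_zero, mul_one, Complex.real_smul]
  generalize (∫ x : ℝ in 0..2 * Real.pi, g (s * Complex.exp (x * Complex.I))) = A
  push_cast
  field_simp

lemma integral_fourier_circle {f : ℂ → ℂ} {s : ℝ} (hs : 0 < s) (k : ℤ) :
    ∫ t : UnitAddCircle, f (s * (AddCircle.toCircle t : Circle)) * fourier (-k) t
        ∂AddCircle.haarAddCircle =
      (s : ℂ) ^ k * ((2 * Real.pi * Complex.I)⁻¹ *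
        ∮ z in C(0, s), (z - 0)⁻¹ • (f z * z ^ (-k))) := by
  rw [← integral_circle_eq (fun z => f z * z ^ (-k)) hs, ← integral_const_mul]
  refine integral_congr_ae (Eventually.of_forall fun t => ?_)
  have hs' : (s : ℂ) ≠ 0 := Complex.ofReal_ne_zero.2 hs.ne'
  dsimp only
  rw [fourier_apply, AddCircle.toCircle_zsmul, Circle.coe_zpow, mul_zpow, zpow_neg, zpow_neg]
  have : (s : ℂ) ^ k ≠ 0 := zpow_ne_zero k hs'
  field_simp

/-- The `k`-th Fourier coefficient of a holomorphic function on the circle of radius `s` is a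
constant multiple of `s ^ k`. -/
lemma integral_fourier_circle_radius {f : ℂ → ℂ} (hf : DifferentiableOn ℂ f (Metric.ball 0 1))
    (k : ℕ) {s s' : ℝ} (hs : 0 < s) (hss' : s ≤ s') (hs1 : s' < 1) :
    (s : ℂ) ^ k * ∫ t : UnitAddCircle, f (s' * (AddCircle.toCircle t : Circle)) *
        fourier (-(k : ℤ)) t ∂AddCircle.haarAddCircle =
      (s' : ℂ) ^ k * ∫ t : UnitAddCircle, f (s * (AddCircle.toCircle t : Circle)) *
        fourier (-(k : ℤ)) t ∂AddCircle.haarAddCircle := by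
  have hd : ∀ z : ℂ, z ∈ Metric.ball (0 : ℂ) 1 → z ≠ 0 →
      DifferentiableAt ℂ (fun z => f z * z ^ (-(k : ℤ))) z := fun z hz hz0 =>
    (hf.differentiableAt (Metric.isOpen_ball.mem_nhds hz)).mul
      (differentiableAt_zpow.2 (Or.inl hz0))
  have hball : ∀ z : ℂ, ‖z‖ ≤ s' → z ∈ Metric.ball (0 : ℂ) 1 := fun z hz => by
    simpa using hz.trans_lt hs1
  have key := Complex.circleIntegral_sub_center_inv_smul_eq_of_differentiable_on_annulus_off_countable
    (c := 0) hs hss' (f := fun z => f z * z ^ (-(k : ℤ))) Set.countable_empty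
    (fun z hz => by
      have h1 : ‖z‖ ≤ s' := by simpa using hz.1
      have h2 : s ≤ ‖z‖ := by simpa using hz.2
      exact (hd z (hball z h1) (norm_pos_iff.1 (hs.trans_le h2))).continuousAt.continuousWithinAt)
    (fun z hz => by
      have h1 : ‖z‖ < s' := by simpa using hz.1.1
      have h2 : s < ‖z‖ := by simpa using hz.1.2
      exact hd z (hball z h1.le) (norm_pos_iff.1 (hs.trans h2)))
  rw [integral_fourier_circle (hs.trans_le hss'), integral_fourier_circle hs, key, zpow_natCast,
    zpow_natCast]
  ring

/-- The Fourier coefficients of negative index of a holomorphic function vanish. -/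
lemma integral_fourier_circle_neg {f : ℂ → ℂ} (hf : DifferentiableOn ℂ f (Metric.ball 0 1))
    (k : ℕ) {s : ℝ} (hs : 0 < s) (hs1 : s < 1) :
    ∫ t : UnitAddCircle, f (s * (AddCircle.toCircle t : Circle)) * fourier (k + 1 : ℤ) t
      ∂AddCircle.haarAddCircle = 0 := by
  have h := integral_fourier_circle (f := f) hs (-(k + 1 : ℤ))
  rw [neg_neg] at h
  have hd : ∀ z ∈ Metric.closedBall (0 : ℂ) s, DifferentiableAt ℂ (fun z => f z * z ^ k) z :=
    fun z hz => (hf.differentiableAt (Metric.isOpen_ball.mem_nhds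
      (Metric.closedBall_subset_ball hs1 hz))).mul (differentiableAt_pow k)
  have h0 : (∮ z in C(0, s), (z - 0)⁻¹ • (f z * z ^ (k + 1 : ℤ))) = 0 := by
    rw [circleIntegral.integral_congr hs.le (g := fun z => f z * z ^ k)]
    · exact Complex.circleIntegral_eq_zero_of_differentiable_on_off_countable hs.le
        Set.countable_empty (fun z hz => (hd z hz).continuousAt.continuousWithinAt)
        fun z hz => hd z (Metric.ball_subset_closedBall hz.1)
    · intro z hz
      have hz0 : z ≠ 0 := by
        rintro rfl
        simp [hs.ne] at hz
      dsimp only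
      rw [sub_zero, smul_eq_mul, zpow_add₀ hz0, zpow_natCast, zpow_one]
      field_simp
  rw [h, h0, mul_zero, mul_zero]

/-! ### Fourier coefficients on the infinite torus -/

/-- The point `(R v_1 w_1, R ^ 2 v_2 w_2, …)` of the domain. -/
def scaledPoint (R : Set.Ioo (0 : ℝ) 1) (v : ℕ → unitInterval) (θ : Torus) : domain :=
  mkPoint (fun j => ((R : ℝ) : ℂ) ^ (j + 1) * ((v j : ℝ) : ℂ) * torusPoint θ j)
    (Summable.of_nonneg_of_le (fun _ => norm_nonneg _) (fun j => by
      rw [norm_mul, norm_mul, norm_torusPoint, mul_one, norm_pow, Complex.norm_real,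
        Complex.norm_real, Real.norm_of_nonneg R.2.1.le, Real.norm_of_nonneg (v j).2.1]
      exact mul_le_of_le_one_right (pow_nonneg R.2.1.le _) (v j).2.2) (summable_radius R))
    (fun j => by
      rw [norm_mul, norm_mul, norm_torusPoint, mul_one, norm_pow, Complex.norm_real,
        Complex.norm_real, Real.norm_of_nonneg R.2.1.le, Real.norm_of_nonneg (v j).2.1]
      exact (mul_le_of_le_one_right (pow_nonneg R.2.1.le _) (v j).2.2).trans_lt
        (pow_lt_one₀ R.2.1.le R.2.2 (Nat.succ_ne_zero j)))

lemma scaledPoint_apply (R : Set.Ioo (0 : ℝ) 1) (v : ℕ → unitInterval) (θ : Torus) (j : ℕ) :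
    (scaledPoint R v θ : EllOne) j =
      ((R : ℝ) : ℂ) ^ (j + 1) * ((v j : ℝ) : ℂ) * torusPoint θ j := rfl

lemma continuous_scaledPoint (R : Set.Ioo (0 : ℝ) 1) :
    Continuous fun x : (ℕ → unitInterval) × Torus => scaledPoint R x.1 x.2 := by
  rw [continuous_iff_continuousAt]
  intro x
  rw [ContinuousAt, tendsto_iff_dist_tendsto_zero]
  have hdist : ∀ y : (ℕ → unitInterval) × Torus,
      dist (scaledPoint R y.1 y.2) (scaledPoint R x.1 x.2) =
      ∑' j, ‖(scaledPoint R y.1 y.2 : EllOne) j - (scaledPoint R x.1 x.2 : EllOne) j‖ := by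
    intro y
    rw [Subtype.dist_eq, dist_eq_norm, EllOne.norm_eq]
    rfl
  simp only [hdist]
  have hb : ∀ (y : (ℕ → unitInterval) × Torus) j,
      ‖(scaledPoint R y.1 y.2 : EllOne) j‖ ≤ (R : ℝ) ^ (j + 1) := by
    intro y j
    rw [scaledPoint_apply, norm_mul, norm_mul, norm_torusPoint, mul_one, norm_pow,
      Complex.norm_real, Complex.norm_real, Real.norm_of_nonneg R.2.1.le,
      Real.norm_of_nonneg (y.1 j).2.1]
    exact mul_le_of_le_one_right (pow_nonneg R.2.1.le _) (y.1 j).2.2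
  have hc : Continuous fun y : (ℕ → unitInterval) × Torus =>
      ∑' j, ‖(scaledPoint R y.1 y.2 : EllOne) j - (scaledPoint R x.1 x.2 : EllOne) j‖ := by
    refine continuous_tsum (u := fun j => (R : ℝ) ^ (j + 1) + (R : ℝ) ^ (j + 1)) (fun j => ?_)
      ((summable_radius R).add (summable_radius R)) (fun j y => ?_)
    · simp only [scaledPoint_apply]
      have h1 : Continuous fun y : (ℕ → unitInterval) × Torus => torusPoint y.2 j :=
        (continuous_torusPoint j).comp continuous_snd
      have h2 : Continuous fun y : (ℕ → unitInterval) × Torus => ((y.1 j : ℝ) : ℂ) :=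
        Complex.continuous_ofReal.comp (continuous_subtype_val.comp
          ((continuous_apply j).comp continuous_fst))
      fun_prop
    · rw [norm_norm]
      exact (norm_sub_le _ _).trans (add_le_add (hb y j) (hb x j))
  simpa using hc.tendsto x

lemma scaledPoint_one (R : Set.Ioo (0 : ℝ) 1) (θ : Torus) :
    scaledPoint R (fun _ => 1) θ = dilate R θ := by
  apply Subtype.ext
  ext j
  rw [scaledPoint_apply, dilate_apply]
  simp [torusPoint]

section Coefficients

variable {F : domain → ℂ}

/-- In the coordinate `J` an analytic function is a holomorphic function of one variable, which
does not depend on the radius used in this coordinate. -/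
lemma exists_slice (hF : IsAnalytic F) (R : Set.Ioo (0 : ℝ) 1) (v : ℕ → unitInterval) (J : ℕ)
    (θ : Torus) : ∃ f : ℂ → ℂ, DifferentiableOn ℂ f (Metric.ball 0 1) ∧
      ∀ (x : unitInterval) (t : UnitAddCircle),
        F (scaledPoint R (Function.update v J x) (θ + Pi.single J t)) =
          f (((R : ℝ) ^ (J + 1) * x : ℝ) * (AddCircle.toCircle t : Circle)) := by
  set c : domain := scaledPoint R (Function.update v J 0) θ
  set η : EllOne := lp.single 1 J (torusPoint θ J) with hη
  have hηj : ∀ j, η j = if j = J then torusPoint θ J else 0 := by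
    intro j
    rw [hη, lp.single_apply, Pi.single_apply]
  have hcj : ∀ j, (c : EllOne) j = if j = J then 0 else
      ((R : ℝ) : ℂ) ^ (j + 1) * ((v j : ℝ) : ℂ) * torusPoint θ j := by
    intro j
    rw [scaledPoint_apply]
    by_cases hj : j = J
    · subst hj
      simp
    · simp [hj]
  have hsum : ∀ z : ℂ, ∀ j, ((c : EllOne) + z • η) j = if j = J then z * torusPoint θ J else
      ((R : ℝ) : ℂ) ^ (j + 1) * ((v j : ℝ) : ℂ) * torusPoint θ j := by
    intro z j
    change (c : EllOne) j + z * η j = _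
    rw [hηj, hcj]
    split_ifs <;> simp
  have hmem : ∀ z : ℂ, ‖z‖ < 1 → (c : EllOne) + z • η ∈ domain := by
    intro z hz j
    have h1 := c.2 j
    rw [hcj] at h1
    rw [hsum]
    split_ifs with hj
    · rwa [norm_mul, norm_torusPoint, mul_one]
    · rwa [if_neg hj] at h1
  refine ⟨fun z => extendZero F (c + z • η), (hF.slice c η).differentiableOn.mono
    fun z hz => hmem z (by simpa using hz), fun x t => ?_⟩
  rw [← extendZero_coe F]
  congr 1
  ext j
  rw [hsum, scaledPoint_apply, torusPoint_add, torusPoint_single]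
  by_cases hj : j = J
  · subst hj
    simp
    ring
  · simp [hj]

/-- Changing one radius from `1` to `x` multiplies the Fourier coefficient by a power of `x`; this
is Cauchy's theorem in the coordinate `J`, after averaging over the rotations of this coordinate. -/
lemma integral_update_radius (hF : IsAnalytic F) (R : Set.Ioo (0 : ℝ) 1) (v : ℕ → unitInterval)
    (J : ℕ) (hv : v J = 1) {x : unitInterval} (hx : 0 < x) (n : ℕ+) :
    ∫ θ, F (scaledPoint R (Function.update v J x) θ) * (starRingEnd ℂ) (torusChar n θ)
        ∂torusMeasure =
      ((x : ℝ) : ℂ) ^ exponent J n *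
        ∫ θ, F (scaledPoint R v θ) * (starRingEnd ℂ) (torusChar n θ) ∂torusMeasure := by
  have hcont : ∀ u : ℕ → unitInterval, Continuous fun θ =>
      F (scaledPoint R u θ) * (starRingEnd ℂ) (torusChar n θ) := fun u =>
    (hF.continuous.comp ((continuous_scaledPoint R).comp (.prodMk_right u))).mul
      (Complex.continuous_conj.comp (continuous_torusChar n))
  rw [integral_rotate (hcont _) J, integral_rotate (hcont _) J, ← integral_const_mul]
  refine integral_congr_ae (Eventually.of_forall fun θ => ?_)
  obtain ⟨f, hf, hf'⟩ := exists_slice hF R v J θ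
  have hconj : ∀ t : UnitAddCircle, (starRingEnd ℂ) (torusChar n (θ + Pi.single J t)) =
      (starRingEnd ℂ) (torusChar n θ) * fourier (-(exponent J n : ℤ)) t := fun t => by
    rw [torusChar_add, torusChar_single, map_mul, toCircle_pow, fourier_neg]
  have h1 : ∀ y : unitInterval, ∀ t : UnitAddCircle,
      F (scaledPoint R (Function.update v J y) (θ + Pi.single J t)) *
        (starRingEnd ℂ) (torusChar n (θ + Pi.single J t)) =
      (starRingEnd ℂ) (torusChar n θ) *
        (f (((R : ℝ) ^ (J + 1) * y : ℝ) * (AddCircle.toCircle t : Circle)) *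
          fourier (-(exponent J n : ℤ)) t) := fun y t => by
    rw [hf', hconj]
    ring
  have h2 := h1 1
  rw [← hv, Function.update_eq_self] at h2
  simp only [h1, h2, integral_const_mul, hv]
  have hR : (0 : ℝ) < (R : ℝ) ^ (J + 1) := pow_pos R.2.1 _
  have key := integral_fourier_circle_radius hf (exponent J n)
    (s := (R : ℝ) ^ (J + 1) * x) (s' := (R : ℝ) ^ (J + 1) * (1 : unitInterval))
    (mul_pos hR hx) (mul_le_mul_of_nonneg_left x.2.2 hR.le)
    (by simpa using pow_lt_one₀ R.2.1.le R.2.2 (Nat.succ_ne_zero J))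
  have hR' : (((R : ℝ) : ℂ) ^ (J + 1)) ^ exponent J n ≠ 0 :=
    pow_ne_zero _ (pow_ne_zero _ (Complex.ofReal_ne_zero.2 R.2.1.ne'))
  have hxR : (((R : ℝ) ^ (J + 1) * x : ℝ) : ℂ) ^ exponent J n =
      (((R : ℝ) : ℂ) ^ (J + 1)) ^ exponent J n * ((x : ℝ) : ℂ) ^ exponent J n := by
    push_cast
    rw [mul_pow]
  have h1R : (((R : ℝ) ^ (J + 1) * (1 : unitInterval) : ℝ) : ℂ) ^ exponent J n =
      (((R : ℝ) : ℂ) ^ (J + 1)) ^ exponent J n := by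
    push_cast
    simp
  rw [hxR, h1R, mul_assoc] at key
  rw [← mul_left_cancel₀ hR' key]
  ring

/-- The Fourier coefficients with respect to characters that have a negative exponent vanish. -/
lemma integral_dilate_eq_zero (hF : IsAnalytic F) (r : Set.Ioo (0 : ℝ) 1) {m n : ℕ+}
    (hmn : ¬ m ∣ n) :
    ∫ θ, F (dilate r θ) * (torusChar m θ * (starRingEnd ℂ) (torusChar n θ)) ∂torusMeasure = 0 := by
  obtain ⟨J, hJ⟩ : ∃ J, exponent J n < exponent J m := by
    by_contra! h
    exact hmn (dvd_of_exponent_le h)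
  obtain ⟨k, hk⟩ : ∃ k : ℕ, (exponent J m : ℤ) + -(exponent J n : ℤ) = k + 1 :=
    ⟨exponent J m - exponent J n - 1, by omega⟩
  have hcont : Continuous fun θ =>
      F (dilate r θ) * (torusChar m θ * (starRingEnd ℂ) (torusChar n θ)) :=
    (hF.continuous.comp (continuous_dilate r)).mul ((continuous_torusChar m).mul
      (Complex.continuous_conj.comp (continuous_torusChar n)))
  rw [integral_rotate hcont J]
  refine integral_eq_zero_of_ae (Eventually.of_forall fun θ => ?_)
  obtain ⟨f, hf, hf'⟩ := exists_slice hF r (fun _ => 1) J θ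
  have h1 : ∀ t : UnitAddCircle, F (dilate r (θ + Pi.single J t)) *
        (torusChar m (θ + Pi.single J t) * (starRingEnd ℂ) (torusChar n (θ + Pi.single J t))) =
      torusChar m θ * (starRingEnd ℂ) (torusChar n θ) *
        (f (((r : ℝ) ^ (J + 1) : ℝ) * (AddCircle.toCircle t : Circle)) *
          fourier (k + 1 : ℤ) t) := fun t => by
    have h2 := hf' 1 t
    have h3 : Function.update (fun _ => 1 : ℕ → unitInterval) J 1 = fun _ => 1 := by simp
    rw [h3, scaledPoint_one] at h2
    rw [h2, torusChar_add, torusChar_add, torusChar_single, torusChar_single, map_mul,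
      toCircle_pow, toCircle_pow, ← fourier_neg, ← hk, fourier_add]
    simp
    ring
  simp only [h1, integral_const_mul]
  rw [integral_fourier_circle_neg hf k (pow_pos r.2.1 _)
    (pow_lt_one₀ r.2.1.le r.2.2 (Nat.succ_ne_zero J)), mul_zero]
  rfl

/-- Dependence of the Fourier coefficients on the radius: the radii are changed coordinate by
coordinate. -/
lemma integral_scaledPoint (hF : IsAnalytic F) (R : Set.Ioo (0 : ℝ) 1) (v : ℕ → unitInterval)
    (hv : ∀ j, 0 < v j) (n : ℕ+) :
    ∫ θ, F (scaledPoint R v θ) * (starRingEnd ℂ) (torusChar n θ) ∂torusMeasure =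
      monomial n (fun j => ((v j : ℝ) : ℂ)) *
        ∫ θ, F (dilate R θ) * (starRingEnd ℂ) (torusChar n θ) ∂torusMeasure := by
  set I : (ℕ → unitInterval) → ℂ := fun u =>
    ∫ θ, F (scaledPoint R u θ) * (starRingEnd ℂ) (torusChar n θ) ∂torusMeasure with hI
  have hI1 : I (fun _ => 1) =
      ∫ θ, F (dilate R θ) * (starRingEnd ℂ) (torusChar n θ) ∂torusMeasure := by
    simp only [hI, scaledPoint_one]
  rw [← hI1]
  -- only the first `N` radii have been changed
  set V : ℕ → ℕ → unitInterval := fun N j => if j < N then v j else 1 with hV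
  have hstep : ∀ N, V (N + 1) = Function.update (V N) N (v N) := fun N => by
    funext j
    simp only [hV]
    by_cases hj : j = N
    · subst hj
      simp
    · have : j < N + 1 ↔ j < N := by omega
      simp [hj, this]
  have hVN : ∀ N, V N N = 1 := fun N => by simp [hV]
  have hind : ∀ N, I (V N) = monomial n (fun j => ((V N j : ℝ) : ℂ)) * I fun _ => 1 := by
    intro N
    induction N with
    | zero =>
      have h0 : V 0 = fun _ => 1 := by simp [hV]
      have h1 : monomial n (fun _ => 1) = 1 := by simp [monomial, Finsupp.prod]
      simp [h0, h1]
    | succ N ih =>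
      have h1 : I (V (N + 1)) = ((v N : ℝ) : ℂ) ^ exponent N n * I (V N) := by
        rw [hstep]
        exact integral_update_radius hF R (V N) N (hVN N) (hv N) n
      have h2 : (fun j => ((V (N + 1) j : ℝ) : ℂ)) = fun j =>
          (if j = N then ((v N : ℝ) : ℂ) else 1) * ((V N j : ℝ) : ℂ) := by
        funext j
        rw [hstep]
        by_cases hj : j = N
        · subst hj
          simp [hVN]
        · simp [hj]
      rw [h1, ih, h2, monomial_mul_apply, monomial_single, mul_assoc]
  have hlim : Tendsto V atTop (𝓝 v) := by
    rw [tendsto_pi_nhds]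
    intro j
    refine tendsto_const_nhds.congr' ?_
    filter_upwards [eventually_gt_atTop j] with N hN
    simp [hV, hN]
  have hcI : Continuous I := by
    have hu : Continuous (Function.uncurry fun (u : ℕ → unitInterval) (θ : Torus) =>
        F (scaledPoint R u θ) * (starRingEnd ℂ) (torusChar n θ)) :=
      (hF.continuous.comp (continuous_scaledPoint R)).mul
        (Complex.continuous_conj.comp ((continuous_torusChar n).comp continuous_snd))
    simpa using continuous_parametric_integral_of_continuous (μ := torusMeasure) hu isCompact_univ
  have hcM : Continuous fun u : ℕ → unitInterval => monomial n (fun j => ((u j : ℝ) : ℂ)) :=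
    continuous_monomial_comp (fun j => Complex.continuous_ofReal.comp
      (continuous_subtype_val.comp (continuous_apply j))) n
  refine tendsto_nhds_unique ((hcI.tendsto v).comp hlim) ?_
  simp only [Function.comp_def, hind]
  exact ((hcM.tendsto v).comp hlim).mul_const _

lemma integral_dilate_of_le (hF : IsAnalytic F) {s r : Set.Ioo (0 : ℝ) 1} (hsr : (s : ℝ) ≤ r)
    (n : ℕ+) :
    radialWeight r n *
        ∫ θ, F (dilate s θ) * (starRingEnd ℂ) (torusChar n θ) ∂torusMeasure =
      radialWeight s n *
        ∫ θ, F (dilate r θ) * (starRingEnd ℂ) (torusChar n θ) ∂torusMeasure := by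
  have hq0 : 0 < (s : ℝ) / r := div_pos s.2.1 r.2.1
  have hq1 : (s : ℝ) / r ≤ 1 := (div_le_one r.2.1).2 hsr
  set v : ℕ → unitInterval := fun j => ⟨((s : ℝ) / r) ^ (j + 1), pow_nonneg hq0.le _,
    pow_le_one₀ hq0.le hq1⟩ with hv
  have hpt : ∀ j, ((r : ℝ) : ℂ) ^ (j + 1) * ((v j : ℝ) : ℂ) = ((s : ℝ) : ℂ) ^ (j + 1) := fun j => by
    have : ((r : ℝ) : ℂ) ≠ 0 := Complex.ofReal_ne_zero.2 r.2.1.ne'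
    simp only [hv]
    push_cast
    rw [← mul_pow, mul_div_cancel₀ _ this]
  have hs : ∀ θ, scaledPoint r v θ = dilate s θ := fun θ => by
    apply Subtype.ext
    ext j
    rw [scaledPoint_apply, dilate_apply, hpt]
    rfl
  have h := integral_scaledPoint hF r v (fun j => pow_pos hq0 (j + 1)) n
  simp only [hs] at h
  rw [h, ← mul_assoc]
  congr 1
  rw [radialWeight, radialWeight, ← monomial_mul_apply]
  simp only [hpt]

/-- The coefficients of an analytic function, computed on the torus `|ζ_j| = 2 ^ (-j)`; by
`integral_dilate_eq` any other radius gives the same value. -/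
def fourierCoefficient (F : domain → ℂ) (n : ℕ+) : ℂ :=
  (radialWeight (1 / 2) n)⁻¹ * ∫ θ, F (dilate ⟨1 / 2, by norm_num, by norm_num⟩ θ) *
    (starRingEnd ℂ) (torusChar n θ) ∂torusMeasure

lemma integral_dilate_eq (hF : IsAnalytic F) (r : Set.Ioo (0 : ℝ) 1) (n : ℕ+) :
    ∫ θ, F (dilate r θ) * (starRingEnd ℂ) (torusChar n θ) ∂torusMeasure =
      fourierCoefficient F n * radialWeight r n := by
  have h0 : radialWeight (1 / 2) n ≠ 0 := radialWeight_ne_zero (by norm_num) n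
  set h : Set.Ioo (0 : ℝ) 1 := ⟨1 / 2, by norm_num, by norm_num⟩ with hh
  have key : radialWeight (1 / 2) n *
        ∫ θ, F (dilate r θ) * (starRingEnd ℂ) (torusChar n θ) ∂torusMeasure =
      radialWeight r n *
        ∫ θ, F (dilate h θ) * (starRingEnd ℂ) (torusChar n θ) ∂torusMeasure := by
    rcases le_total (r : ℝ) (1 / 2) with hr | hr
    · exact integral_dilate_of_le hF (s := r) (r := h) hr n
    · exact (integral_dilate_of_le hF (s := h) (r := r) hr n).symm
  rw [fourierCoefficient, mul_comm _ (radialWeight r n), mul_left_comm, ← key,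
    inv_mul_cancel_left₀ h0]

end Coefficients

/-! ### Monomial expansions of functions in the Hardy space -/

/-- The character `w ↦ w ^ α(n)` as a bundled continuous function. -/
def torusCharMap (n : ℕ+) : C(Torus, ℂ) := ⟨torusChar n, continuous_torusChar n⟩

lemma integral_conj_torusChar_mul (m n : ℕ+) :
    ∫ θ, (starRingEnd ℂ) (torusChar n θ) * torusChar m θ ∂torusMeasure =
      if m = n then 1 else 0 := by
  split_ifs with h
  · subst h
    have : ∀ θ, (starRingEnd ℂ) (torusChar m θ) * torusChar m θ = 1 := fun θ => by
      rw [mul_comm, Complex.mul_conj, Complex.normSq_eq_norm_sq, norm_torusChar]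
      simp
    simp [this]
  · exact torusChar_orthogonal h

lemma orthonormal_torusChar : Orthonormal ℂ fun n : ℕ+ =>
    ContinuousMap.toLp (E := ℂ) 2 torusMeasure ℂ (torusCharMap n) := by
  rw [orthonormal_iff_ite]
  intro n m
  rw [ContinuousMap.inner_toLp]
  refine Eq.trans ?_ ((integral_conj_torusChar_mul m n).trans (if_congr eq_comm rfl rfl))
  exact integral_congr_ae (Eventually.of_forall fun θ => mul_comm _ _)

/-- A continuous function on the infinite torus is zero if all its Fourier coefficients are; the
characters `w ^ α(m) * conj (w ^ α(n))` span a dense subspace by the Stone–Weierstrass theorem. -/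
lemma eq_zero_of_integral_eq_zero {H : Torus → ℂ} (hH : Continuous H)
    (h : ∀ m n : ℕ+,
      ∫ θ, H θ * (torusChar m θ * (starRingEnd ℂ) (torusChar n θ)) ∂torusMeasure = 0) :
    ∀ᵐ θ ∂torusMeasure, H θ = 0 := by
  set A : StarSubalgebra ℂ C(Torus, ℂ) := StarAlgebra.adjoin ℂ (Set.range torusCharMap) with hA
  have hsep : A.SeparatesPoints := by
    intro θ τ hne
    obtain ⟨j, hj⟩ : ∃ j, θ j ≠ τ j := Function.ne_iff.1 hne
    let q : ℕ+ := ⟨Nat.nth Nat.Prime j, (Nat.prime_nth_prime j).pos⟩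
    refine ⟨torusCharMap q, ⟨torusCharMap q, StarAlgebra.subset_adjoin ℂ _ ⟨q, rfl⟩, rfl⟩, ?_⟩
    have hq : ∀ θ, torusCharMap q θ = torusPoint θ j := fun θ => by
      refine (monomial_prime q (Nat.prime_nth_prime j) _).trans ?_
      exact congrArg _ (Nat.count_nth_of_infinite Nat.infinite_setOfPred_prime j)
    rw [hq, hq]
    exact fun hEq => hj (AddCircle.injective_toCircle one_ne_zero (Subtype.ext hEq))
  have hdense := ContinuousMap.starSubalgebra_topologicalClosure_eq_top_of_separatesPoints A hsep
  -- the functions annihilated by `H` against all characters are stable under multiplication by `A`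
  let V : Set C(Torus, ℂ) := {g | ∀ m n : ℕ+,
    ∫ θ, H θ * g θ * (torusChar m θ * (starRingEnd ℂ) (torusChar n θ)) ∂torusMeasure = 0}
  have hint : ∀ (g : C(Torus, ℂ)) (m n : ℕ+), Integrable
      (fun θ => H θ * g θ * (torusChar m θ * (starRingEnd ℂ) (torusChar n θ))) torusMeasure :=
    fun g m n => integrable_of_continuous ((hH.mul g.continuous).mul
      ((continuous_torusChar m).mul (Complex.continuous_conj.comp (continuous_torusChar n))))
  have hV1 : (1 : C(Torus, ℂ)) ∈ V := fun m n => by simpa using h m n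
  have hVadd : ∀ f g, f ∈ V → g ∈ V → f + g ∈ V := fun f g hf hg m n => by
    have := integral_add (hint f m n) (hint g m n)
    rw [hf, hg, add_zero] at this
    rw [← this]
    congr 1
    funext θ
    rw [ContinuousMap.add_apply]
    ring
  have hVsmul : ∀ (c : ℂ) g, g ∈ V → algebraMap ℂ C(Torus, ℂ) c * g ∈ V := fun c g hg m n => by
    have := integral_const_mul (μ := torusMeasure) c
      fun θ => H θ * g θ * (torusChar m θ * (starRingEnd ℂ) (torusChar n θ))
    rw [hg, mul_zero] at this
    rw [← this]
    congr 1
    funext θ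
    rw [Algebra.algebraMap_eq_smul_one, smul_one_mul, ContinuousMap.smul_apply, smul_eq_mul]
    ring
  have hAV : ∀ f ∈ A, (∀ g ∈ V, f * g ∈ V) ∧ ∀ g ∈ V, star f * g ∈ V := by
    intro f hf
    refine StarAlgebra.adjoin_induction (p := fun f _ => (∀ g ∈ V, f * g ∈ V) ∧
      ∀ g ∈ V, star f * g ∈ V) ?_ ?_ ?_ ?_ ?_ hf
    · rintro _ ⟨k, rfl⟩
      constructor
      · intro g hg m n
        rw [← hg (k * m) n]
        congr 1
        funext θ
        rw [torusChar_mul, ContinuousMap.mul_apply]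
        change H θ * (torusChar k θ * g θ) * _ = _
        ring
      · intro g hg m n
        rw [← hg m (k * n)]
        congr 1
        funext θ
        rw [torusChar_mul, ContinuousMap.mul_apply, map_mul]
        change H θ * ((starRingEnd ℂ) (torusChar k θ) * g θ) * _ = _
        ring
    · intro c
      refine ⟨fun g hg => hVsmul c g hg, fun g hg => ?_⟩
      rw [← algebraMap_star_comm]
      exact hVsmul _ g hg
    · rintro f₁ f₂ - - ⟨h1, h1'⟩ ⟨h2, h2'⟩
      refine ⟨fun g hg => ?_, fun g hg => ?_⟩
      · rw [add_mul]
        exact hVadd _ _ (h1 g hg) (h2 g hg)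
      · rw [star_add, add_mul]
        exact hVadd _ _ (h1' g hg) (h2' g hg)
    · rintro f₁ f₂ - - ⟨h1, h1'⟩ ⟨h2, h2'⟩
      refine ⟨fun g hg => ?_, fun g hg => ?_⟩
      · rw [mul_assoc]
        exact h1 _ (h2 g hg)
      · rw [star_mul, mul_assoc]
        exact h2' _ (h1' g hg)
    · rintro f - ⟨h1, h1'⟩
      exact ⟨h1', by simpa using h1⟩
  have hzero : ∀ f ∈ A, ∫ θ, H θ * f θ ∂torusMeasure = 0 := fun f hf => by
    have := (hAV f hf).1 1 hV1 1 1
    simpa [torusChar, monomial_one] using this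
  have hcont : Continuous fun f : C(Torus, ℂ) => ∫ θ, H θ * f θ ∂torusMeasure := by
    have hu : Continuous (Function.uncurry fun (f : C(Torus, ℂ)) (θ : Torus) => H θ * f θ) :=
      (hH.comp continuous_snd).mul (continuous_eval (F := C(Torus, ℂ)))
    refine continuous_iff_continuousAt.2 fun f => ?_
    obtain ⟨B, hB⟩ := isCompact_univ.exists_bound_of_continuousOn hH.continuousOn
    refine continuousAt_of_dominated (bound := fun _ => B * (‖f‖ + 1))
      (Eventually.of_forall fun g => (hH.mul g.continuous).aestronglyMeasurable) ?_
      (integrable_const _) (Eventually.of_forall fun θ => ?_)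
    · filter_upwards [Metric.ball_mem_nhds f one_pos] with g hg
      refine Eventually.of_forall fun θ => ?_
      rw [norm_mul]
      have h1 : ‖g θ‖ ≤ ‖f‖ + 1 := by
        have h2 : ‖g‖ ≤ ‖f‖ + ‖g - f‖ := by simpa using norm_add_le f (g - f)
        rw [Metric.mem_ball, dist_eq_norm] at hg
        exact (g.norm_coe_le_norm θ).trans (by linarith)
      exact mul_le_mul (hB θ trivial) h1 (norm_nonneg _) ((norm_nonneg _).trans (hB θ trivial))
    · exact (hu.comp (.prodMk_left θ)).continuousAt
  have hall : ∀ f : C(Torus, ℂ), ∫ θ, H θ * f θ ∂torusMeasure = 0 := by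
    have hcl : IsClosed {f : C(Torus, ℂ) | ∫ θ, H θ * f θ ∂torusMeasure = 0} :=
      isClosed_eq hcont continuous_const
    intro f
    have hf : f ∈ A.topologicalClosure := by
      rw [hdense]
      trivial
    exact closure_minimal (s := (A : Set C(Torus, ℂ))) hzero hcl hf
  have h2 := hall (star ⟨H, hH⟩)
  have h3 : ∀ θ, H θ * (star (⟨H, hH⟩ : C(Torus, ℂ))) θ = ((‖H θ‖ ^ 2 : ℝ) : ℂ) := fun θ => by
    change H θ * (starRingEnd ℂ) (H θ) = _
    rw [Complex.mul_conj, Complex.normSq_eq_norm_sq]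
  simp only [h3] at h2
  rw [integral_complex_ofReal, Complex.ofReal_eq_zero,
    integral_eq_zero_iff_of_nonneg (fun θ => sq_nonneg _)] at h2
  · filter_upwards [h2] with θ hθ
    simpa using hθ
  · rw [← integrableOn_univ]
    exact (hH.norm.pow 2).continuousOn.integrableOn_compact isCompact_univ

lemma continuous_dilate_comp {F : domain → ℂ} (hF : IsAnalytic F) (r : Set.Ioo (0 : ℝ) 1) :
    Continuous fun θ => F (dilate r θ) := hF.continuous.comp (continuous_dilate r)

lemma HasMonomialExpansion.integral_dilate {F : domain → ℂ} {a : ℕ+ → ℂ}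
    (h : HasMonomialExpansion F a) (r : Set.Ioo (0 : ℝ) 1) (n : ℕ+) :
    ∫ θ, F (dilate r θ) * (starRingEnd ℂ) (torusChar n θ) ∂torusMeasure =
      a n * radialWeight r n := by
  set f : ℕ+ → Torus → ℂ := fun m θ =>
    a m * radialWeight r m * ((starRingEnd ℂ) (torusChar n θ) * torusChar m θ) with hf
  have hnorm : ∀ m θ, ‖f m θ‖ = ‖a m * monomial m (dilate r 0 : EllOne)‖ := fun m θ => by
    rw [monomial_dilate]
    simp [hf, norm_torusChar]
  have hint : ∀ m, Integrable (f m) torusMeasure := fun m => integrable_of_continuous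
    (continuous_const.mul ((Complex.continuous_conj.comp (continuous_torusChar n)).mul
      (continuous_torusChar m)))
  have hsum : ∀ θ, F (dilate r θ) * (starRingEnd ℂ) (torusChar n θ) = ∑' m, f m θ := fun θ => by
    rw [← ((h.hasSum (dilate r θ)).mul_right _).tsum_eq]
    refine tsum_congr fun m => ?_
    rw [monomial_dilate]
    simp only [hf]
    ring
  have hval : ∀ m, ∫ θ, f m θ ∂torusMeasure = if m = n then a n * radialWeight r n else 0 := by
    intro m
    simp only [hf, integral_const_mul, integral_conj_torusChar_mul]
    split_ifs with hmn
    · rw [hmn, mul_one]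
    · rw [mul_zero]
  have key := hasSum_integral_of_summable_integral_norm hint (by
    simpa [hnorm] using h.summable_norm (dilate r 0))
  simp only [hsum]
  refine key.unique ?_
  simp only [hval]
  exact hasSum_ite_eq n _

lemma HasMonomialExpansion.unique {F : domain → ℂ} {a b : ℕ+ → ℂ}
    (ha : HasMonomialExpansion F a) (hb : HasMonomialExpansion F b) : a = b := by
  funext n
  have h := (ha.integral_dilate ⟨1 / 2, by norm_num, by norm_num⟩ n).symm.trans
    (hb.integral_dilate ⟨1 / 2, by norm_num, by norm_num⟩ n)
  exact mul_right_cancel₀ (radialWeight_ne_zero (by norm_num) n) h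

lemma HasMonomialExpansion.coeff_eq {F : domain → ℂ} {a : ℕ+ → ℂ}
    (h : HasMonomialExpansion F a) : coeff F = a := by
  have hex : ∃ a, HasMonomialExpansion F a := ⟨a, h⟩
  rw [coeff, dif_pos hex]
  exact hex.choose_spec.unique h

/-- Bessel's inequality on the torus of radius `r`. -/
lemma sum_norm_sq_radialWeight_le {F : domain → ℂ} (hF : MemHardy 2 F) (r : Set.Ioo (0 : ℝ) 1)
    (s : Finset ℕ+) :
    ∑ n ∈ s, ‖fourierCoefficient F n * radialWeight r n‖ ^ 2 ≤ (hardyENorm 2 F).toReal ^ 2 := by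
  set f : C(Torus, ℂ) := ⟨fun θ => F (dilate r θ), continuous_dilate_comp hF.1 r⟩
  have h1 := orthonormal_torusChar.sum_inner_products_le
    (ContinuousMap.toLp (E := ℂ) 2 torusMeasure ℂ f) (s := s)
  have h2 : ∀ n, inner ℂ (ContinuousMap.toLp (E := ℂ) 2 torusMeasure ℂ (torusCharMap n))
      (ContinuousMap.toLp (E := ℂ) 2 torusMeasure ℂ f) =
      fourierCoefficient F n * radialWeight r n := fun n => by
    rw [ContinuousMap.inner_toLp]
    exact integral_dilate_eq hF.1 r n
  simp only [h2] at h1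
  refine h1.trans ?_
  gcongr
  rw [Lp.norm_def, eLpNorm_congr_ae (ContinuousMap.coeFn_toLp (𝕜 := ℂ) torusMeasure f)]
  exact ENNReal.toReal_mono hF.2.ne
    (le_iSup (fun r => eLpNorm (fun θ => F (dilate r θ)) 2 torusMeasure) r)

/-- Bessel's inequality in the limit `r → 1`. -/
lemma sum_norm_sq_fourierCoefficient_le {F : domain → ℂ} (hF : MemHardy 2 F) (s : Finset ℕ+) :
    ∑ n ∈ s, ‖fourierCoefficient F n‖ ^ 2 ≤ (hardyENorm 2 F).toReal ^ 2 := by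
  have hc : ∀ n, Continuous fun r : ℝ => radialWeight r n := fun n =>
    continuous_monomial_comp (fun j => Complex.continuous_ofReal.pow (j + 1)) n
  have h1 : ∀ n, radialWeight 1 n = 1 := fun n => by simp [radialWeight, monomial, Finsupp.prod]
  have hlim : Tendsto (fun r : ℝ => ∑ n ∈ s, ‖fourierCoefficient F n * radialWeight r n‖ ^ 2)
      (𝓝[<] 1) (𝓝 (∑ n ∈ s, ‖fourierCoefficient F n‖ ^ 2)) := by
    have : Continuous fun r : ℝ => ∑ n ∈ s, ‖fourierCoefficient F n * radialWeight r n‖ ^ 2 :=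
      continuous_finsetSum _ fun n _ => (continuous_const.mul (hc n)).norm.pow 2
    have h := this.tendsto 1
    simp only [h1, mul_one] at h
    exact h.mono_left nhdsWithin_le_nhds
  refine le_of_tendsto hlim ?_
  filter_upwards [Ioo_mem_nhdsLT (zero_lt_one (α := ℝ))] with r hr
  exact sum_norm_sq_radialWeight_le hF ⟨r, hr⟩ s

lemma norm_fourierCoefficient_le {F : domain → ℂ} (hF : MemHardy 2 F) (n : ℕ+) :
    ‖fourierCoefficient F n‖ ≤ (hardyENorm 2 F).toReal := by
  have h := sum_norm_sq_fourierCoefficient_le hF {n}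
  rw [Finset.sum_singleton] at h
  exact (pow_le_pow_iff_left₀ (norm_nonneg _) ENNReal.toReal_nonneg two_ne_zero).1 h

/-- The difference between a function in the Hardy space and the sum of its Fourier series has no
nonzero Fourier coefficient on any torus, hence vanishes. -/
theorem MemHardy.hasMonomialExpansion {F : domain → ℂ} (hF : MemHardy 2 F) :
    HasMonomialExpansion F (fourierCoefficient F) := by
  have hb := norm_fourierCoefficient_le hF
  have hS := hasMonomialExpansion_monomialSum hb
  have hSan := isAnalytic_monomialSum hb
  set S := monomialSum (fourierCoefficient F)
  have hGan : IsAnalytic (F + (-1 : ℂ) • S) := hF.1.add (hSan.smul _)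
  have hcoef : ∀ r n, ∫ θ, (F + (-1 : ℂ) • S) (dilate r θ) * (starRingEnd ℂ) (torusChar n θ)
      ∂torusMeasure = 0 := by
    intro r n
    have hi : ∀ {G : domain → ℂ}, IsAnalytic G → Integrable
        (fun θ => G (dilate r θ) * (starRingEnd ℂ) (torusChar n θ)) torusMeasure := fun hG =>
      integrable_of_continuous ((continuous_dilate_comp hG r).mul
        (Complex.continuous_conj.comp (continuous_torusChar n)))
    have h1 := integral_sub (hi hF.1) (hi hSan)
    rw [integral_dilate_eq hF.1, hS.integral_dilate, sub_self] at h1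
    rw [← h1]
    congr 1
    funext θ
    simp only [Pi.add_apply, Pi.smul_apply, smul_eq_mul]
    ring
  have hzero : hardyENorm 2 (F + (-1 : ℂ) • S) = 0 := by
    rw [hardyENorm, ENNReal.iSup_eq_zero]
    intro r
    rw [eLpNorm_eq_zero_iff (hGan.aestronglyMeasurable r) two_ne_zero]
    refine eq_zero_of_integral_eq_zero (continuous_dilate_comp hGan r) fun m n => ?_
    by_cases hmn : m ∣ n
    · obtain ⟨k, rfl⟩ := hmn
      rw [← hcoef r k]
      congr 1
      funext θ
      have : torusChar m θ * (starRingEnd ℂ) (torusChar m θ) = 1 := by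
        rw [Complex.mul_conj, Complex.normSq_eq_norm_sq, norm_torusChar]
        simp
      rw [torusChar_mul, map_mul, ← mul_assoc (torusChar m θ), this, one_mul]
    · exact integral_dilate_eq_zero hGan r hmn
  have hG := eq_zero_of_hardyENorm_eq_zero one_le_two hGan hzero
  have hFS : F = S := by
    rw [neg_one_smul, ← sub_eq_add_neg, sub_eq_zero] at hG
    exact hG
  rw [← hFS] at hS
  exact hS

/-! ### Polynomials in the Hardy space -/

lemma norm_monomial_le_one (n : ℕ+) (ζ : domain) : ‖monomial n (ζ : EllOne)‖ ≤ 1 := by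
  rw [← norm_monomial_eq_one n (ζ := fun _ => 1) (fun _ => norm_one)]
  exact norm_monomial_mono n fun j => by simpa using (ζ.2 j).le

lemma isAnalytic_monomial (n : ℕ+) : IsAnalytic fun ζ : domain => monomial n (ζ : EllOne) := by
  have h : monomialSum (Pi.single n 1) = fun ζ : domain => monomial n (ζ : EllOne) := by
    funext ζ
    rw [monomialSum, tsum_eq_single n]
    · simp
    · intro m hm
      simp [hm]
  rw [← h]
  refine isAnalytic_monomialSum (C := 1) fun m => ?_
  rw [Pi.single_apply]
  split_ifs <;> simp

section

variable {p : ℝ≥0∞} [Fact (1 ≤ p)]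

/-- The monomial with index `n`, as an element of the Hardy space. -/
def hardyMonomial (p : ℝ≥0∞) [Fact (1 ≤ p)] (n : ℕ+) : HardySpace p :=
  ⟨fun ζ : domain => monomial n (ζ : EllOne), isAnalytic_monomial n, by
    refine (iSup_le fun r => ?_).trans_lt ENNReal.one_lt_top
    refine (eLpNorm_mono (g := fun _ => (1 : ℝ)) fun θ => ?_).trans ?_
    · simpa using norm_monomial_le_one n (dilate r θ)
    · rw [eLpNorm_const _ (zero_lt_one.trans_le Fact.out).ne' (IsProbabilityMeasure.ne_zero _)]
      simp⟩

lemma HardySpace.enorm_eq (F : HardySpace p) : ‖F‖ₑ = hardyENorm p F := by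
  rw [← ofReal_norm, HardySpace.norm_def, ENNReal.ofReal_toReal]
  exact F.2.2.ne

/-- The polynomial `∑_{n ∈ s} b_n ζ ^ α(n)`, as an element of the Hardy space. -/
def hardyPolynomial (p : ℝ≥0∞) [Fact (1 ≤ p)] (s : Finset ℕ+) (b : ℕ+ → ℂ) : HardySpace p :=
  ∑ n ∈ s, b n • hardyMonomial p n

lemma hardyPolynomial_apply (s : Finset ℕ+) (b : ℕ+ → ℂ) (ζ : domain) :
    hardyPolynomial p s b ζ = ∑ n ∈ s, b n * monomial n (ζ : EllOne) := by
  classical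
  rw [hardyPolynomial]
  induction s using Finset.induction_on with
  | empty => rfl
  | insert n s hn ih =>
    rw [Finset.sum_insert hn, Finset.sum_insert hn, ← ih]
    rfl

/-- Maximum principle: since `z ↦ ∑ b_n z ^ |n| w ^ α(n)` is a polynomial with values in `L ^ p` of
the torus, whose norm is constant on the unit circle by rotation invariance, the Hardy norm of a
polynomial is at most its norm on the torus. -/
lemma eLpNorm_polynomial_dilate_le (s : Finset ℕ+) (b : ℕ+ → ℂ) (r : Set.Ioo (0 : ℝ) 1) :
    eLpNorm (fun θ => ∑ n ∈ s, b n * monomial n (dilate r θ : EllOne)) p torusMeasure ≤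
      eLpNorm (fun θ => ∑ n ∈ s, b n * torusChar n θ) p torusMeasure := by
  let Q : ℂ → C(Torus, ℂ) := fun z =>
    ∑ n ∈ s, (b n * monomial n fun j => z ^ (j + 1)) • torusCharMap n
  have hQ : ∀ z θ, Q z θ = ∑ n ∈ s, (b n * monomial n fun j => z ^ (j + 1)) * torusChar n θ :=
    fun z θ => by
      rw [ContinuousMap.sum_apply]
      rfl
  set g : ℂ → Lp ℂ p torusMeasure := fun z => ContinuousMap.toLp (E := ℂ) p torusMeasure ℂ (Q z)
    with hg
  have hgd : Differentiable ℂ g := by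
    refine (ContinuousMap.toLp (E := ℂ) p torusMeasure ℂ).differentiable.comp ?_
    refine Differentiable.fun_sum fun n _ => ?_
    refine Differentiable.smul_const (Differentiable.const_mul ?_ _) _
    exact differentiable_monomial_comp (fun j => differentiable_id.pow (j + 1)) n
  have hgn : ∀ z, ‖g z‖ₑ = eLpNorm (Q z) p torusMeasure := fun z => by
    rw [hg, Lp.enorm_def]
    exact eLpNorm_congr_ae (ContinuousMap.coeFn_toLp (𝕜 := ℂ) torusMeasure (Q z))
  have hone : (Q 1 : Torus → ℂ) = fun θ => ∑ n ∈ s, b n * torusChar n θ := by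
    funext θ
    rw [hQ]
    refine Finset.sum_congr rfl fun n _ => ?_
    have : (monomial n fun j => (1 : ℂ) ^ (j + 1)) = 1 := by simp [monomial, Finsupp.prod]
    rw [this, mul_one]
  have hcirc : ∀ z : ℂ, ‖z‖ = 1 → ‖g z‖ₑ = ‖g 1‖ₑ := by
    intro z hz
    obtain ⟨t, ht⟩ := (AddCircle.homeomorphCircle (one_ne_zero (α := ℝ))).surjective
      (⟨z, by simpa [Submonoid.unitSphere] using! hz⟩ : Circle)
    rw [AddCircle.homeomorphCircle_apply] at ht
    let τ : Torus := fun j => (j + 1) • t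
    have hτ : torusPoint τ = fun j => z ^ (j + 1) := by
      funext j
      simp only [τ, torusPoint]
      rw [AddCircle.toCircle_nsmul, ht]
      rfl
    have hrot : (Q z : Torus → ℂ) = (fun θ => Q 1 θ) ∘ fun θ => θ + τ := by
      funext θ
      rw [Function.comp_apply, hone, hQ]
      refine Finset.sum_congr rfl fun n _ => ?_
      rw [torusChar_add, mul_assoc, mul_comm (torusChar n θ)]
      rw [torusChar, torusChar, hτ]
    rw [hgn, hgn, hrot]
    exact eLpNorm_comp_measurePreserving (Q 1).continuous.aestronglyMeasurable
      (measurePreserving_add_torus τ)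
  have hr : (Q (r : ℝ) : Torus → ℂ) =
      fun θ => ∑ n ∈ s, b n * monomial n (dilate r θ : EllOne) := by
    funext θ
    rw [hQ]
    refine Finset.sum_congr rfl fun n _ => ?_
    rw [monomial_dilate, radialWeight, mul_assoc]
  have hmax : ‖g (r : ℝ)‖ ≤ ‖g 1‖ := by
    refine Complex.norm_le_of_forall_mem_frontier_norm_le (U := Metric.ball 0 1)
      Metric.isBounded_ball hgd.diffContOnCl (fun z hz => ?_) (subset_closure ?_)
    · rw [frontier_ball _ one_ne_zero, mem_sphere_zero_iff_norm] at hz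
      have := congrArg ENNReal.toReal (hcirc z hz)
      rw [toReal_enorm, toReal_enorm] at this
      exact this.le
    · simpa [abs_of_pos r.2.1] using r.2.2
  rw [← hr, ← hone, ← hgn, ← hgn]
  exact enorm_le_iff_norm_le.2 hmax

lemma enorm_hardyPolynomial_le (s : Finset ℕ+) (b : ℕ+ → ℂ) :
    ‖hardyPolynomial p s b‖ₑ ≤ eLpNorm (fun θ => ∑ n ∈ s, b n * torusChar n θ) p torusMeasure := by
  rw [HardySpace.enorm_eq]
  refine iSup_le fun r => ?_
  simp only [hardyPolynomial_apply]
  exact eLpNorm_polynomial_dilate_le s b r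

end

/-! ### Moments of linear combinations of a Gaussian process -/

/-- The quadratic form of a bounded matrix is bounded. -/
lemma quadratic_form_le {K : ℕ+ → ℕ+ → ℝ} {A : EllTwo →L[ℂ] EllTwo}
    (hA : ∀ m n, A (lp.single 2 n (1 : ℂ)) m = (K m n : ℂ)) (s : Finset ℕ+) (u : ℕ+ → ℝ) :
    ∑ m ∈ s, ∑ n ∈ s, u m * u n * K m n ≤ ‖A‖ * ∑ n ∈ s, u n ^ 2 := by
  set x : EllTwo := ∑ n ∈ s, lp.single 2 n (u n : ℂ) with hx
  have hAn : ∀ m n, A (lp.single 2 n (u n : ℂ)) m = (u n : ℂ) * K m n := by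
    intro m n
    have h1 : (lp.single 2 n (u n : ℂ) : EllTwo) = (u n : ℂ) • lp.single 2 n (1 : ℂ) := by
      rw [← lp.single_smul, smul_eq_mul, mul_one]
    rw [h1, map_smul, ← hA]
    rfl
  have hAx : ∀ m, (A x) m = ∑ n ∈ s, (u n : ℂ) * K m n := by
    intro m
    rw [hx, map_sum, lp.coeFn_sum, Finset.sum_apply]
    exact Finset.sum_congr rfl fun n _ => hAn m n
  have hin : inner ℂ x (A x) = ((∑ m ∈ s, ∑ n ∈ s, u m * u n * K m n : ℝ) : ℂ) := by
    rw [hx, sum_inner, ← hx, Complex.ofReal_sum]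
    refine Finset.sum_congr rfl fun m _ => ?_
    rw [lp.inner_single_left, hAx, Complex.ofReal_sum, inner_sum]
    refine Finset.sum_congr rfl fun n _ => ?_
    simp
    ring
  have hnorm : ‖x‖ ^ 2 = ∑ n ∈ s, u n ^ 2 := by
    have := lp.norm_sum_single (E := fun _ : ℕ+ => ℂ) (p := 2) (by norm_num)
      (fun n => (u n : ℂ)) s
    simpa using this
  have h := norm_inner_le_norm (𝕜 := ℂ) x (A x)
  rw [hin, Complex.norm_real] at h
  calc _ ≤ ‖∑ m ∈ s, ∑ n ∈ s, u m * u n * K m n‖ := Real.le_norm_self _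
    _ ≤ ‖x‖ * ‖A x‖ := h
    _ ≤ ‖x‖ * (‖A‖ * ‖x‖) := by gcongr; exact A.le_opNorm x
    _ = ‖A‖ * ‖x‖ ^ 2 := by ring
    _ = _ := by rw [hnorm]

/-- The norm in `L ^ q` of the standard normal distribution. -/
def gaussianMoment (q : ℝ≥0∞) : ℝ≥0∞ := eLpNorm id q (gaussianReal 0 1)

lemma gaussianMoment_lt_top {q : ℝ≥0∞} (hq : q ≠ ∞) : gaussianMoment q < ∞ :=
  (memLp_id_gaussianReal' q hq).2

section

variable {Ω : Type*} [MeasurableSpace Ω] {P : Measure Ω}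

/-- All moments of a centered Gaussian variable are determined by its variance. -/
lemma eLpNorm_of_hasGaussianLaw {Z : Ω → ℝ} (hZ : HasGaussianLaw Z P) (h0 : ∫ ω, Z ω ∂P = 0)
    (q : ℝ≥0∞) :
    eLpNorm Z q P = ENNReal.ofReal √(∫ ω, Z ω ^ 2 ∂P) * gaussianMoment q := by
  have hvar : Var[Z; P] = ∫ ω, Z ω ^ 2 ∂P :=
    variance_of_integral_eq_zero hZ.aemeasurable h0
  have hmap := hZ.map_eq_gaussianReal
  rw [h0, hvar] at hmap
  set v := ∫ ω, Z ω ^ 2 ∂P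
  have hv : 0 ≤ v := integral_nonneg fun ω => sq_nonneg _
  have h1 : eLpNorm Z q P = eLpNorm id q (P.map Z) :=
    (eLpNorm_map_measure aestronglyMeasurable_id hZ.aemeasurable).symm
  have h2 : gaussianReal 0 v.toNNReal = (gaussianReal 0 1).map (√v * ·) := by
    rw [gaussianReal_map_const_mul, mul_zero, mul_one]
    congr 1
    apply NNReal.eq
    rw [Real.coe_toNNReal _ hv]
    exact (Real.sq_sqrt hv).symm
  rw [h1, hmap, h2, eLpNorm_map_measure aestronglyMeasurable_id (by fun_prop)]
  have h3 : (id ∘ fun x : ℝ => √v * x) = √v • (id : ℝ → ℝ) := rfl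
  rw [h3, eLpNorm_const_smul, gaussianMoment, Real.enorm_eq_ofReal (Real.sqrt_nonneg _)]

variable {X : ℕ+ → Ω → ℝ}

lemma integral_sq_sum (hX : IsGaussianProcess X P) (s : Finset ℕ+) (u : ℕ+ → ℝ) :
    ∫ ω, (∑ n ∈ s, u n * X n ω) ^ 2 ∂P =
      ∑ m ∈ s, ∑ n ∈ s, u m * u n * ∫ ω, X m ω * X n ω ∂P := by
  have hint : ∀ m n, Integrable (fun ω => u m * u n * (X m ω * X n ω)) P := fun m n =>
    ((hX.hasGaussianLaw_eval m).memLp_two.integrable_mul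
      (hX.hasGaussianLaw_eval n).memLp_two).const_mul _
  have h1 : ∀ ω, (∑ n ∈ s, u n * X n ω) ^ 2 =
      ∑ m ∈ s, ∑ n ∈ s, u m * u n * (X m ω * X n ω) := fun ω => by
    rw [sq, Finset.sum_mul_sum]
    exact Finset.sum_congr rfl fun m _ => Finset.sum_congr rfl fun n _ => by ring
  simp only [h1]
  rw [integral_finsetSum _ fun m _ => integrable_finsetSum _ fun n _ => hint m n]
  refine Finset.sum_congr rfl fun m _ => ?_
  rw [integral_finsetSum _ fun n _ => hint m n]
  exact Finset.sum_congr rfl fun n _ => integral_const_mul _ _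

variable {A : EllTwo →L[ℂ] EllTwo}

lemma eLpNorm_sum_le (hX : IsGaussianProcess X P) (h0 : ∀ n, ∫ ω, X n ω ∂P = 0)
    (hA : ∀ m n, A (lp.single 2 n (1 : ℂ)) m = ((∫ ω, X m ω * X n ω ∂P : ℝ) : ℂ))
    (q : ℝ≥0∞) (s : Finset ℕ+) (u : ℕ+ → ℝ) :
    eLpNorm (fun ω => ∑ n ∈ s, u n * X n ω) q P ≤
      ENNReal.ofReal √(‖A‖ * ∑ n ∈ s, u n ^ 2) * gaussianMoment q := by
  have hlaw : HasGaussianLaw (fun ω => ∑ n ∈ s, u n * X n ω) P :=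
    (hX.smul u).hasGaussianLaw_fun_sum
  have hmean : ∫ ω, ∑ n ∈ s, u n * X n ω ∂P = 0 := by
    rw [integral_finsetSum _ fun n _ => (hX.hasGaussianLaw_eval n).integrable.const_mul _]
    exact Finset.sum_eq_zero fun n _ => by rw [integral_const_mul, h0, mul_zero]
  rw [eLpNorm_of_hasGaussianLaw hlaw hmean, integral_sq_sum hX]
  gcongr
  exact quadratic_form_le (K := fun m n => ∫ ω, X m ω * X n ω ∂P) hA s u

lemma eLpNorm_complex_sum_le (hX : IsGaussianProcess X P) (h0 : ∀ n, ∫ ω, X n ω ∂P = 0)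
    (hA : ∀ m n, A (lp.single 2 n (1 : ℂ)) m = ((∫ ω, X m ω * X n ω ∂P : ℝ) : ℂ))
    {q : ℝ≥0∞} (hq : 1 ≤ q) (s : Finset ℕ+) (c : ℕ+ → ℂ) :
    eLpNorm (fun ω => ∑ n ∈ s, c n * (X n ω : ℂ)) q P ≤
      2 * gaussianMoment q * ENNReal.ofReal √(‖A‖ * ∑ n ∈ s, ‖c n‖ ^ 2) := by
  set f : Ω → ℝ := fun ω => ∑ n ∈ s, (c n).re * X n ω
  set g : Ω → ℝ := fun ω => ∑ n ∈ s, (c n).im * X n ω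
  have hsplit : (fun ω => ∑ n ∈ s, c n * (X n ω : ℂ)) =
      (fun ω => (f ω : ℂ)) + fun ω => (g ω : ℂ) * Complex.I := by
    funext ω
    simp only [f, g, Pi.add_apply, Complex.ofReal_sum, Finset.sum_mul, Complex.ofReal_mul]
    rw [← Finset.sum_add_distrib]
    refine Finset.sum_congr rfl fun n _ => ?_
    conv_lhs => rw [← Complex.re_add_im (c n)]
    ring
  have hfm : AEMeasurable f P :=
    Finset.aemeasurable_fun_sum _ fun n _ => (hX.aemeasurable n).const_mul _
  have hgm : AEMeasurable g P :=
    Finset.aemeasurable_fun_sum _ fun n _ => (hX.aemeasurable n).const_mul _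
  have hf : eLpNorm (fun ω => (f ω : ℂ)) q P = eLpNorm f q P :=
    eLpNorm_congr_norm_ae (Eventually.of_forall fun ω => by simp)
  have hg : eLpNorm (fun ω => (g ω : ℂ) * Complex.I) q P = eLpNorm g q P :=
    eLpNorm_congr_norm_ae (Eventually.of_forall fun ω => by simp)
  have hre : ∑ n ∈ s, (c n).re ^ 2 ≤ ∑ n ∈ s, ‖c n‖ ^ 2 := Finset.sum_le_sum fun n _ => by
    rw [← sq_abs]
    exact pow_le_pow_left₀ (abs_nonneg _) (Complex.abs_re_le_norm _) 2
  have him : ∑ n ∈ s, (c n).im ^ 2 ≤ ∑ n ∈ s, ‖c n‖ ^ 2 := Finset.sum_le_sum fun n _ => by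
    rw [← sq_abs]
    exact pow_le_pow_left₀ (abs_nonneg _) (Complex.abs_im_le_norm _) 2
  have hfm' : AEMeasurable (fun ω => (f ω : ℂ)) P := Complex.measurable_ofReal.comp_aemeasurable hfm
  have hgm' : AEMeasurable (fun ω => (g ω : ℂ) * Complex.I) P :=
    (Complex.measurable_ofReal.comp_aemeasurable hgm).mul_const _
  rw [hsplit]
  refine (eLpNorm_add_le hfm'.aestronglyMeasurable hgm'.aestronglyMeasurable hq).trans ?_
  rw [hf, hg]
  calc eLpNorm f q P + eLpNorm g q P
      ≤ ENNReal.ofReal √(‖A‖ * ∑ n ∈ s, (c n).re ^ 2) * gaussianMoment q +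
        ENNReal.ofReal √(‖A‖ * ∑ n ∈ s, (c n).im ^ 2) * gaussianMoment q :=
        add_le_add (eLpNorm_sum_le hX h0 hA q s _) (eLpNorm_sum_le hX h0 hA q s _)
    _ ≤ ENNReal.ofReal √(‖A‖ * ∑ n ∈ s, ‖c n‖ ^ 2) * gaussianMoment q +
        ENNReal.ofReal √(‖A‖ * ∑ n ∈ s, ‖c n‖ ^ 2) * gaussianMoment q := by gcongr
    _ = _ := by ring

/-- The second moment of a random polynomial in the Hardy space is controlled by the coefficients:
the norm is at most the `L ^ q` norm on the torus for `q = max p 2`, and for every point of the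
torus the value of the polynomial is Gaussian. -/
lemma eLpNorm_random_polynomial_le [IsProbabilityMeasure P] (hX : IsGaussianProcess X P)
    (h0 : ∀ n, ∫ ω, X n ω ∂P = 0)
    (hA : ∀ m n, A (lp.single 2 n (1 : ℂ)) m = ((∫ ω, X m ω * X n ω ∂P : ℝ) : ℂ))
    {p : ℝ≥0∞} [Fact (1 ≤ p)] (hp : p ≠ ∞) (s : Finset ℕ+) (a : ℕ+ → ℂ) :
    eLpNorm (fun ω => hardyPolynomial p s fun n => a n * (X n ω : ℂ)) 2 P ≤
      2 * gaussianMoment (max p 2) * ENNReal.ofReal √(‖A‖ * ∑ n ∈ s, ‖a n‖ ^ 2) := by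
  set q : ℝ≥0∞ := max p 2
  have hq : q ≠ ∞ := (max_lt hp.lt_top ENNReal.ofNat_lt_top).ne
  have hq0 : q ≠ 0 := (two_pos.trans_le (le_max_right p 2)).ne'
  have hq1 : 1 ≤ q := one_le_two.trans (le_max_right _ _)
  have hqr : 0 < q.toReal := ENNReal.toReal_pos hq0 hq
  set D : ℝ≥0∞ := 2 * gaussianMoment q * ENNReal.ofReal √(‖A‖ * ∑ n ∈ s, ‖a n‖ ^ 2)
  have hXm : ∀ n, AEMeasurable (fun ω => ((X n ω : ℝ) : ℂ)) P := fun n =>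
    Complex.measurable_ofReal.comp_aemeasurable (hX.aemeasurable n)
  have hmeas : AEStronglyMeasurable
      (fun ω => hardyPolynomial p s fun n => a n * (X n ω : ℂ)) P :=
    Finset.aestronglyMeasurable_fun_sum _ fun n _ =>
      ((hXm n).const_mul _).aestronglyMeasurable.smul_const _
  refine (eLpNorm_le_eLpNorm_of_exponent_le (le_max_right p 2) hmeas).trans ?_
  rw [eLpNorm_eq_lintegral_rpow_enorm_toReal hq0 hq, one_div, ENNReal.rpow_inv_le_iff hqr]
  have hjoint : AEMeasurable (Function.uncurry fun (ω : Ω) (θ : Torus) =>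
      ‖∑ n ∈ s, a n * (X n ω : ℂ) * torusChar n θ‖ₑ ^ q.toReal) (P.prod torusMeasure) := by
    refine AEMeasurable.pow_const (AEMeasurable.enorm ?_) _
    refine Finset.aemeasurable_fun_sum _ fun n _ => ?_
    exact ((hXm n).const_mul (a n)).comp_fst.mul
      ((continuous_torusChar n).measurable.comp measurable_snd).aemeasurable
  calc ∫⁻ ω, ‖hardyPolynomial p s fun n => a n * (X n ω : ℂ)‖ₑ ^ q.toReal ∂P
      ≤ ∫⁻ ω, ∫⁻ θ, ‖∑ n ∈ s, a n * (X n ω : ℂ) * torusChar n θ‖ₑ ^ q.toReal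
          ∂torusMeasure ∂P := by
        refine lintegral_mono fun ω => ?_
        have hc : Continuous fun θ => ∑ n ∈ s, a n * (X n ω : ℂ) * torusChar n θ :=
          continuous_finsetSum _ fun n _ => continuous_const.mul (continuous_torusChar n)
        have h1 := (enorm_hardyPolynomial_le (p := p) s fun n => a n * (X n ω : ℂ)).trans
          (eLpNorm_le_eLpNorm_of_exponent_le (le_max_left p 2) hc.aestronglyMeasurable)
        rwa [eLpNorm_eq_lintegral_rpow_enorm_toReal hq0 hq, one_div,
          ENNReal.le_rpow_inv_iff hqr] at h1
    _ = ∫⁻ θ, ∫⁻ ω, ‖∑ n ∈ s, a n * (X n ω : ℂ) * torusChar n θ‖ₑ ^ q.toReal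
          ∂P ∂torusMeasure := lintegral_lintegral_swap hjoint
    _ ≤ ∫⁻ _, D ^ q.toReal ∂torusMeasure := by
        refine lintegral_mono fun θ => ?_
        have h1 := eLpNorm_complex_sum_le hX h0 hA hq1 s fun n => a n * torusChar n θ
        simp only [norm_mul, norm_torusChar, mul_one] at h1
        rw [eLpNorm_eq_lintegral_rpow_enorm_toReal hq0 hq, one_div,
          ENNReal.rpow_inv_le_iff hqr] at h1
        refine le_trans (le_of_eq ?_) h1
        refine lintegral_congr fun ω => ?_
        congr 2
        exact Finset.sum_congr rfl fun n _ => by ring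
    _ = D ^ q.toReal := by simp

end

/-! ### Random series -/

open Classical in
/-- A function on the domain as an element of the Hardy space, with the value zero if it does not
belong to the Hardy space. -/
def toHardySpace (p : ℝ≥0∞) [Fact (1 ≤ p)] (F : domain → ℂ) : HardySpace p :=
  if h : MemHardy p F then ⟨F, h⟩ else 0

lemma toHardySpace_coe {p : ℝ≥0∞} [Fact (1 ≤ p)] {F : domain → ℂ} (h : MemHardy p F) :
    (toHardySpace p F : domain → ℂ) = F :=
  congrArg HardySpace.toFun (dif_pos h : toHardySpace p F = (⟨F, h⟩ : HardySpace p))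

/-- Fatou's lemma for the Hardy norm, applied to the partial sums of a series of monomials. -/
lemma hardyENorm_sub_le_liminf {p : ℝ≥0∞} [Fact (1 ≤ p)] {b : ℕ+ → ℂ} {C : ℝ}
    (hb : ∀ n, ‖b n‖ ≤ C) {T : ℕ → Finset ℕ+} (hT : Tendsto T atTop atTop) (s : Finset ℕ+) :
    hardyENorm p (monomialSum b - hardyPolynomial p s b) ≤
      liminf (fun M => ‖hardyPolynomial p (T M) b - hardyPolynomial p s b‖ₑ) atTop := by
  refine iSup_le fun r => ?_
  have hmeas : ∀ M, AEStronglyMeasurable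
      (fun θ => (hardyPolynomial p (T M) b - hardyPolynomial p s b : HardySpace p) (dilate r θ))
      torusMeasure := fun M =>
    (hardyPolynomial p (T M) b - hardyPolynomial p s b : HardySpace p).2.1.aestronglyMeasurable r
  refine (Lp.eLpNorm_lim_le_liminf_eLpNorm hmeas _ (Eventually.of_forall fun θ => ?_)).trans
    (liminf_le_liminf (Eventually.of_forall fun M => ?_))
  · have h1 := ((hasMonomialExpansion_monomialSum hb).hasSum (dilate r θ)).comp hT
    have h2 := h1.sub_const (hardyPolynomial p s b (dilate r θ))
    refine h2.congr fun M => ?_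
    rw [Function.comp_apply, ← hardyPolynomial_apply (p := p)]
    rfl
  · rw [HardySpace.enorm_eq]
    exact le_iSup (fun r => eLpNorm (fun θ =>
      (hardyPolynomial p (T M) b - hardyPolynomial p s b : HardySpace p) (dilate r θ)) p
      torusMeasure) r

section

variable {Ω : Type*} [MeasurableSpace Ω] {P : Measure Ω}
  {X : ℕ+ → Ω → ℝ} {A : EllTwo →L[ℂ] EllTwo}

lemma integral_sq_le (hA : ∀ m n, A (lp.single 2 n (1 : ℂ)) m =
    ((∫ ω, X m ω * X n ω ∂P : ℝ) : ℂ)) (n : ℕ+) : ∫ ω, X n ω ^ 2 ∂P ≤ ‖A‖ := by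
  have h := quadratic_form_le (K := fun m n => ∫ ω, X m ω * X n ω ∂P) hA {n} fun _ => 1
  simpa [sq] using h

/-- Square summable coefficients almost surely remain bounded after the randomization. -/
lemma ae_bounded_coeff (hX : IsGaussianProcess X P)
    (hA : ∀ m n, A (lp.single 2 n (1 : ℂ)) m = ((∫ ω, X m ω * X n ω ∂P : ℝ) : ℂ))
    {a : ℕ+ → ℂ} (ha : Summable fun n => ‖a n‖ ^ 2) :
    ∀ᵐ ω ∂P, ∃ C, ∀ n, ‖a n * (X n ω : ℂ)‖ ≤ C := by
  have hmeas : ∀ n, AEMeasurable (fun ω => ENNReal.ofReal (‖a n‖ ^ 2 * X n ω ^ 2)) P := fun n =>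
    (((hX.aemeasurable n).pow_const 2).const_mul _).ennreal_ofReal
  have hint : ∀ n, ∫⁻ ω, ENNReal.ofReal (‖a n‖ ^ 2 * X n ω ^ 2) ∂P ≤
      ENNReal.ofReal (‖a n‖ ^ 2 * ‖A‖) := fun n => by
    rw [← ofReal_integral_eq_lintegral_ofReal
      ((hX.hasGaussianLaw_eval n).memLp_two.integrable_sq.const_mul _)
      (Eventually.of_forall fun ω => by positivity), integral_const_mul]
    gcongr
    exact integral_sq_le hA n
  have hfin : ∫⁻ ω, ∑' n, ENNReal.ofReal (‖a n‖ ^ 2 * X n ω ^ 2) ∂P ≠ ∞ := by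
    rw [lintegral_tsum hmeas]
    exact ne_top_of_le_ne_top (ha.mul_right ‖A‖).tsum_ofReal_ne_top (ENNReal.tsum_le_tsum hint)
  filter_upwards [ae_lt_top' (AEMeasurable.tsum hmeas) hfin] with ω hω
  refine ⟨√(∑' n, ENNReal.ofReal (‖a n‖ ^ 2 * X n ω ^ 2)).toReal, fun n => Real.le_sqrt_of_sq_le ?_⟩
  have h1 := ENNReal.toReal_mono hω.ne
    (ENNReal.le_tsum (f := fun n => ENNReal.ofReal (‖a n‖ ^ 2 * X n ω ^ 2)) n)
  rw [ENNReal.toReal_ofReal (by positivity)] at h1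
  rwa [norm_mul, mul_pow, Complex.norm_real, Real.norm_eq_abs, sq_abs]

/-- The constant in the estimate of random series. -/
def randomConst (p : ℝ≥0∞) : ℝ≥0∞ := 2 * gaussianMoment (max p 2)

lemma randomConst_ne_top {p : ℝ≥0∞} (hp : p ≠ ∞) : randomConst p ≠ ∞ :=
  ENNReal.mul_ne_top (by simp)
    (gaussianMoment_lt_top (max_lt hp.lt_top ENNReal.ofNat_lt_top).ne).ne

/-- A random series with square summable coefficients almost surely belongs to the Hardy space, and
is the limit in probability, in the Hardy norm, of its partial sums. -/
theorem memHardy_random_series [IsProbabilityMeasure P] (hX : IsGaussianProcess X P)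
    (h0 : ∀ n, ∫ ω, X n ω ∂P = 0)
    (hA : ∀ m n, A (lp.single 2 n (1 : ℂ)) m = ((∫ ω, X m ω * X n ω ∂P : ℝ) : ℂ))
    {p : ℝ≥0∞} [Fact (1 ≤ p)] (hp : p ≠ ∞) {a : ℕ+ → ℂ} (ha : Summable fun n => ‖a n‖ ^ 2) :
    (∀ᵐ ω ∂P, MemHardy p (monomialSum fun n => a n * (X n ω : ℂ))) ∧
    AEStronglyMeasurable (fun ω => toHardySpace p (monomialSum fun n => a n * (X n ω : ℂ))) P ∧
    eLpNorm (fun ω => toHardySpace p (monomialSum fun n => a n * (X n ω : ℂ))) 2 P ≤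
      randomConst p * ENNReal.ofReal √(‖A‖ * ∑' n, ‖a n‖ ^ 2) := by
  set T : ℕ → Finset ℕ+ := fun N => Finset.Iic (Nat.succPNat N) with hT
  have hTmono : Monotone T := fun M N hMN =>
    Finset.Iic_subset_Iic.2 (Nat.succPNat_mono hMN)
  have hTlim : Tendsto T atTop atTop := tendsto_atTop_finset_of_monotone hTmono fun n =>
    ⟨n.natPred, by simp [hT]⟩
  set Y : Ω → HardySpace p := fun ω => toHardySpace p (monomialSum fun n => a n * (X n ω : ℂ))
    with hY
  set S : ℕ → Ω → HardySpace p := fun N ω => hardyPolynomial p (T N) fun n => a n * (X n ω : ℂ)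
    with hS
  have hSm : ∀ N, AEStronglyMeasurable (S N) P := fun N =>
    Finset.aestronglyMeasurable_fun_sum _ fun n _ =>
      ((Complex.measurable_ofReal.comp_aemeasurable (hX.aemeasurable n)).const_mul
        (a n)).aestronglyMeasurable.smul_const _
  set ε : ℕ → ℝ≥0∞ := fun N => randomConst p *
    ENNReal.ofReal √(‖A‖ * (∑' n, ‖a n‖ ^ 2 - ∑ n ∈ T N, ‖a n‖ ^ 2)) with hε
  have hεlim : Tendsto ε atTop (𝓝 0) := by
    have h1 : Tendsto (fun N => ∑' n, ‖a n‖ ^ 2 - ∑ n ∈ T N, ‖a n‖ ^ 2) atTop (𝓝 0) := by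
      have h := (ha.hasSum.comp hTlim).const_sub (∑' n, ‖a n‖ ^ 2)
      rwa [sub_self] at h
    have h2 : Continuous fun x : ℝ => ENNReal.ofReal √(‖A‖ * x) :=
      ENNReal.continuous_ofReal.comp (by fun_prop)
    have h3 := ENNReal.Tendsto.const_mul (a := randomConst p) ((h2.tendsto 0).comp h1)
      (Or.inr (randomConst_ne_top hp))
    rwa [mul_zero, Real.sqrt_zero, ENNReal.ofReal_zero, mul_zero] at h3
  have hεfin : ∀ N, ε N ≠ ∞ := fun N =>
    ENNReal.mul_ne_top (randomConst_ne_top hp) ENNReal.ofReal_ne_top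
  -- the increments of the partial sums
  have hdiff : ∀ M N, N ≤ M → ∫⁻ ω, ‖S M ω - S N ω‖ₑ ∂P ≤ ε N := by
    intro M N hNM
    have h1 : S M - S N =
        fun ω => hardyPolynomial p (T M \ T N) fun n => a n * (X n ω : ℂ) := by
      funext ω
      exact (Finset.sum_sdiff_eq_sub (hTmono hNM)).symm
    rw [← eLpNorm_one_eq_lintegral_enorm]
    refine (eLpNorm_le_eLpNorm_of_exponent_le one_le_two ((hSm M).sub (hSm N))).trans ?_
    rw [h1]
    refine (eLpNorm_random_polynomial_le hX h0 hA hp _ a).trans ?_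
    change _ ≤ 2 * gaussianMoment (max p 2) *
      ENNReal.ofReal √(‖A‖ * (∑' n, ‖a n‖ ^ 2 - ∑ n ∈ T N, ‖a n‖ ^ 2))
    gcongr
    rw [Finset.sum_sdiff_eq_sub (hTmono hNM)]
    gcongr
    exact ha.sum_le_tsum _ fun _ _ => sq_nonneg _
  set H : ℕ → Ω → ℝ≥0∞ := fun N ω => liminf (fun M => ‖S M ω - S N ω‖ₑ) atTop with hH
  have hHm : ∀ N, AEMeasurable (H N) P := fun N => by
    simp only [hH, liminf_eq_iSup_iInf_of_nat']
    exact AEMeasurable.iSup fun n => AEMeasurable.iInf fun i => ((hSm _).sub (hSm N)).enorm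
  have hHint : ∀ N, ∫⁻ ω, H N ω ∂P ≤ ε N := fun N => by
    refine (lintegral_liminf_le' fun M => ((hSm M).sub (hSm N)).enorm).trans ?_
    refine liminf_le_of_frequently_le' (Eventually.frequently ?_)
    filter_upwards [eventually_ge_atTop N] with M hM using hdiff M N hM
  have hbdd := ae_bounded_coeff hX hA ha
  have hmem : ∀ᵐ ω ∂P, MemHardy p (monomialSum fun n => a n * (X n ω : ℂ)) := by
    filter_upwards [hbdd, ae_lt_top' (hHm 0) ((hHint 0).trans_lt (hεfin 0).lt_top).ne]
      with ω ⟨C, hC⟩ hω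
    have han := isAnalytic_monomialSum hC
    have h1 := (hardyENorm_sub_le_liminf (p := p) hC hTlim (T 0)).trans_lt hω
    have han' : IsAnalytic (monomialSum (fun n => a n * (X n ω : ℂ)) - S 0 ω) := by
      rw [sub_eq_add_neg, ← neg_one_smul ℂ]
      exact han.add ((S 0 ω).2.1.smul _)
    have h2 := hardyENorm_add_le (p := p) Fact.out han' (S 0 ω).2.1
    have h3 : (monomialSum (fun n => a n * (X n ω : ℂ)) - S 0 ω) + (S 0 ω).1 =
        monomialSum (fun n => a n * (X n ω : ℂ)) := sub_add_cancel _ _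
    rw [h3] at h2
    exact ⟨han, h2.trans_lt (ENNReal.add_lt_top.2 ⟨h1, (S 0 ω).2.2⟩)⟩
  have hYS : ∀ N, ∀ᵐ ω ∂P, edist (S N ω) (Y ω) ≤ H N ω := fun N => by
    filter_upwards [hbdd, hmem] with ω ⟨C, hC⟩ hω
    rw [edist_comm, edist_eq_enorm_sub, HardySpace.enorm_eq]
    have h1 : ((Y ω - S N ω : HardySpace p) : domain → ℂ) =
        monomialSum (fun n => a n * (X n ω : ℂ)) - S N ω :=
      congrArg (fun G : domain → ℂ => G - S N ω) (toHardySpace_coe hω)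
    rw [h1]
    exact hardyENorm_sub_le_liminf hC hTlim (T N)
  have htim : TendstoInMeasure P S atTop Y := by
    refine tendstoInMeasure_of_ne_top fun δ hδ hδ' => ?_
    have h1 : Tendsto (fun N => ε N / δ) atTop (𝓝 0) := by
      simpa using ENNReal.Tendsto.div_const hεlim (Or.inr hδ.ne')
    refine tendsto_of_tendsto_of_tendsto_of_le_of_le tendsto_const_nhds h1
      (fun _ => zero_le) fun N => ?_
    calc P {ω | δ ≤ edist (S N ω) (Y ω)} ≤ P {ω | δ ≤ H N ω} :=
          measure_mono_ae ((hYS N).mono fun ω hω h => le_trans h hω)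
      _ ≤ (∫⁻ ω, H N ω ∂P) / δ := meas_ge_le_lintegral_div (hHm N) hδ.ne' hδ'
      _ ≤ ε N / δ := by gcongr; exact hHint N
  obtain ⟨ns, -, hns⟩ := htim.exists_seq_tendsto_ae
  refine ⟨hmem, aestronglyMeasurable_of_tendsto_ae atTop (fun i => hSm (ns i)) hns,
    Lp.eLpNorm_le_of_ae_tendsto (Eventually.of_forall fun i => ?_) (fun i => hSm (ns i)) hns⟩
  refine (eLpNorm_random_polynomial_le hX h0 hA hp _ a).trans ?_
  rw [randomConst]
  gcongr
  exact ha.sum_le_tsum _ fun _ _ => sq_nonneg _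

end

/-! ### The randomization operator -/

lemma coeff_eq_fourierCoefficient (F : HardySpace 2) : coeff F = fourierCoefficient F :=
  (MemHardy.hasMonomialExpansion F.2).coeff_eq

lemma summable_sq_coeff (F : HardySpace 2) : Summable fun n => ‖coeff F n‖ ^ 2 := by
  rw [coeff_eq_fourierCoefficient]
  exact summable_of_sum_le (fun _ => sq_nonneg _) (sum_norm_sq_fourierCoefficient_le F.2)

lemma tsum_sq_coeff_le (F : HardySpace 2) : ∑' n, ‖coeff F n‖ ^ 2 ≤ ‖F‖ ^ 2 := by
  refine (summable_sq_coeff F).tsum_le_of_sum_le fun s => ?_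
  rw [coeff_eq_fourierCoefficient]
  exact sum_norm_sq_fourierCoefficient_le F.2 s

lemma coeff_add (F G : HardySpace 2) : coeff (F + G : HardySpace 2) = coeff F + coeff G := by
  simp only [coeff_eq_fourierCoefficient]
  funext n
  have hi : ∀ F : HardySpace 2, Integrable (fun θ =>
      F (dilate ⟨1 / 2, by norm_num, by norm_num⟩ θ) *
      (starRingEnd ℂ) (torusChar n θ)) torusMeasure := fun F =>
    integrable_of_continuous ((continuous_dilate_comp F.2.1 _).mul
      (Complex.continuous_conj.comp (continuous_torusChar n)))
  rw [Pi.add_apply, fourierCoefficient, fourierCoefficient, fourierCoefficient, ← mul_add,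
    ← integral_add (hi F) (hi G)]
  congr 2
  funext θ
  exact add_mul _ _ _

lemma coeff_smul (c : ℂ) (F : HardySpace 2) : coeff (c • F : HardySpace 2) = c • coeff F := by
  simp only [coeff_eq_fourierCoefficient]
  funext n
  rw [Pi.smul_apply, fourierCoefficient, fourierCoefficient, smul_eq_mul,
    mul_left_comm c, ← integral_const_mul c]
  congr 2
  funext θ
  exact mul_assoc _ _ _

section

variable {Ω : Type*} [MeasurableSpace Ω] {P : Measure Ω} [IsProbabilityMeasure P]
  {X : ℕ+ → Ω → ℝ} {A : EllTwo →L[ℂ] EllTwo}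

lemma memLp_randomization (hX : IsGaussianProcess X P) (h0 : ∀ n, ∫ ω, X n ω ∂P = 0)
    (hA : ∀ m n, A (lp.single 2 n (1 : ℂ)) m = ((∫ ω, X m ω * X n ω ∂P : ℝ) : ℂ))
    {p : ℝ≥0∞} [Fact (1 ≤ p)] (hp : p ≠ ∞) (F : HardySpace 2) :
    MemLp (fun ω => toHardySpace p (randomization X F ω)) 2 P :=
  ⟨(memHardy_random_series hX h0 hA hp (summable_sq_coeff F)).2.1,
    (memHardy_random_series hX h0 hA hp (summable_sq_coeff F)).2.2.trans_lt
      (ENNReal.mul_lt_top (randomConst_ne_top hp).lt_top ENNReal.ofReal_lt_top)⟩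

lemma eLpNorm_randomization_le (hX : IsGaussianProcess X P) (h0 : ∀ n, ∫ ω, X n ω ∂P = 0)
    (hA : ∀ m n, A (lp.single 2 n (1 : ℂ)) m = ((∫ ω, X m ω * X n ω ∂P : ℝ) : ℂ))
    {p : ℝ≥0∞} [Fact (1 ≤ p)] (hp : p ≠ ∞) (F : HardySpace 2) :
    (eLpNorm (fun ω => toHardySpace p (randomization X F ω)) 2 P).toReal ≤
      (randomConst p).toReal * √‖A‖ * ‖F‖ := by
  have h1 := (memHardy_random_series hX h0 hA hp (summable_sq_coeff F)).2.2
  have h2 := ENNReal.toReal_mono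
    (ENNReal.mul_ne_top (randomConst_ne_top hp) ENNReal.ofReal_ne_top) h1
  rw [ENNReal.toReal_mul, ENNReal.toReal_ofReal (Real.sqrt_nonneg _)] at h2
  refine h2.trans ?_
  rw [mul_assoc]
  gcongr
  calc √(‖A‖ * ∑' n, ‖coeff F n‖ ^ 2) ≤ √(‖A‖ * ‖F‖ ^ 2) := by
        gcongr
        exact tsum_sq_coeff_le F
    _ = √‖A‖ * ‖F‖ := by rw [Real.sqrt_mul (norm_nonneg _), Real.sqrt_sq (norm_nonneg _)]

lemma toHardySpace_randomization_add (hX : IsGaussianProcess X P) (h0 : ∀ n, ∫ ω, X n ω ∂P = 0)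
    (hA : ∀ m n, A (lp.single 2 n (1 : ℂ)) m = ((∫ ω, X m ω * X n ω ∂P : ℝ) : ℂ))
    {p : ℝ≥0∞} [Fact (1 ≤ p)] (hp : p ≠ ∞) (F G : HardySpace 2) :
    ∀ᵐ ω ∂P, toHardySpace p (randomization X (F + G : HardySpace 2) ω) =
      toHardySpace p (randomization X F ω) + toHardySpace p (randomization X G ω) := by
  filter_upwards [ae_bounded_coeff hX hA (summable_sq_coeff F),
    ae_bounded_coeff hX hA (summable_sq_coeff G),
    (memHardy_random_series hX h0 hA hp (summable_sq_coeff F)).1,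
    (memHardy_random_series hX h0 hA hp (summable_sq_coeff G)).1] with ω ⟨C, hC⟩ ⟨D, hD⟩ hF hG
  have hsum : randomization X (F + G : HardySpace 2) ω =
      randomization X F ω + randomization X G ω := by
    funext ζ
    rw [Pi.add_apply]
    refine HasSum.tsum_eq ?_
    refine (((hasMonomialExpansion_monomialSum hC).hasSum ζ).add
      ((hasMonomialExpansion_monomialSum hD).hasSum ζ)).congr_fun fun n => ?_
    rw [coeff_add, Pi.add_apply]
    ring
  have hFG : MemHardy p (randomization X F ω + randomization X G ω) :=
    (hardySubmodule p).add_mem hF hG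
  refine Subtype.ext ?_
  rw [hsum]
  exact (toHardySpace_coe hFG).trans
    (congrArg₂ (· + ·) (toHardySpace_coe hF).symm (toHardySpace_coe hG).symm)

lemma toHardySpace_randomization_smul (hX : IsGaussianProcess X P) (h0 : ∀ n, ∫ ω, X n ω ∂P = 0)
    (hA : ∀ m n, A (lp.single 2 n (1 : ℂ)) m = ((∫ ω, X m ω * X n ω ∂P : ℝ) : ℂ))
    {p : ℝ≥0∞} [Fact (1 ≤ p)] (hp : p ≠ ∞) (c : ℂ) (F : HardySpace 2) :
    ∀ᵐ ω ∂P, toHardySpace p (randomization X (c • F : HardySpace 2) ω) =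
      c • toHardySpace p (randomization X F ω) := by
  filter_upwards [(memHardy_random_series hX h0 hA hp (summable_sq_coeff F)).1] with ω hF
  have hsum : randomization X (c • F : HardySpace 2) ω = c • randomization X F ω := by
    funext ζ
    rw [Pi.smul_apply, randomization, randomization, smul_eq_mul, ← tsum_mul_left]
    refine tsum_congr fun n => ?_
    rw [coeff_smul, Pi.smul_apply, smul_eq_mul]
    ring
  have hcF : MemHardy p (c • randomization X F ω) := (hardySubmodule p).smul_mem c hF
  refine Subtype.ext ?_
  rw [hsum]
  exact (toHardySpace_coe hcF).trans (congrArg (c • ·) (toHardySpace_coe hF).symm)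

/-- The randomization as a bounded linear operator. -/
def randomizationCLM (hX : IsGaussianProcess X P) (h0 : ∀ n, ∫ ω, X n ω ∂P = 0)
    (hA : ∀ m n, A (lp.single 2 n (1 : ℂ)) m = ((∫ ω, X m ω * X n ω ∂P : ℝ) : ℂ))
    {p : ℝ≥0∞} [Fact (1 ≤ p)] (hp : p ≠ ∞) : HardySpace 2 →L[ℂ] Lp (HardySpace p) 2 P :=
  LinearMap.mkContinuous
    { toFun := fun F => (memLp_randomization hX h0 hA hp F).toLp _
      map_add' := fun F G => by
        rw [← MemLp.toLp_add, MemLp.toLp_eq_toLp_iff]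
        exact toHardySpace_randomization_add hX h0 hA hp F G
      map_smul' := fun c F => by
        rw [RingHom.id_apply, ← MemLp.toLp_const_smul, MemLp.toLp_eq_toLp_iff]
        exact toHardySpace_randomization_smul hX h0 hA hp c F }
    ((randomConst p).toReal * √‖A‖) fun F => by
      rw [LinearMap.coe_mk, AddHom.coe_mk, Lp.norm_toLp]
      exact eLpNorm_randomization_le hX h0 hA hp F

end

end InfHardy

end

theorem theorem3p1 {Ω : Type*} [MeasurableSpace Ω] (P : Measure Ω) [IsProbabilityMeasure P]
    (p : ℝ≥0∞) [Fact (1 ≤ p)] (hp : p ≠ ∞)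
    (X : ℕ+ → Ω → ℝ) (hX : IsGaussianProcess X P) (hcentered : ∀ n, ∫ ω, X n ω ∂P = 0)
    (hK : InfHardy.IsBoundedMatrix fun m n => ∫ ω, X m ω * X n ω ∂P) :
    (∀ F : InfHardy.HardySpace 2, ∃! a : ℕ+ → ℂ, InfHardy.HasMonomialExpansion F a) ∧
    (∃ R : InfHardy.HardySpace 2 →L[ℂ] Lp (InfHardy.HardySpace p) 2 P,
      ∀ F : InfHardy.HardySpace 2, ∀ᵐ ω ∂P,
        (R F ω : InfHardy.domain → ℂ) = InfHardy.randomization X F ω) ∧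
    (∀ F : InfHardy.HardySpace 2, ∀ᵐ ω ∂P,
      InfHardy.HasMonomialExpansion (InfHardy.randomization X F ω)
        (fun n => InfHardy.coeff F n * (X n ω : ℂ)) ∧
      InfHardy.MemHardy p (InfHardy.randomization X F ω)) := by
  obtain ⟨A, hA⟩ := hK
  refine ⟨fun F => ?_, ⟨InfHardy.randomizationCLM hX hcentered hA hp, fun F => ?_⟩, fun F => ?_⟩
  · have h := InfHardy.MemHardy.hasMonomialExpansion F.2
    exact ⟨_, h, fun b hb => hb.unique h⟩
  · filter_upwards [(InfHardy.memLp_randomization hX hcentered hA hp F).coeFn_toLp,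
      (InfHardy.memHardy_random_series hX hcentered hA hp (InfHardy.summable_sq_coeff F)).1]
      with ω h1 h2
    exact (congrArg InfHardy.HardySpace.toFun h1).trans (InfHardy.toHardySpace_coe h2)
  · filter_upwards [InfHardy.ae_bounded_coeff hX hA (InfHardy.summable_sq_coeff F),
      (InfHardy.memHardy_random_series hX hcentered hA hp (InfHardy.summable_sq_coeff F)).1]
      with ω ⟨C, hC⟩ h2
    exact ⟨InfHardy.hasMonomialExpansion_monomialSum hC, h2⟩
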